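/- **Setting.** Let $X$ be a smooth ($C^\infty$, Hausdorff) manifold of dimension $n$ with cotangent bundle $T^*$, $E$ a smooth real vector bundle of finite rank over $X$, and $R_q\subset J_q(E)$ a linear system of order $q$, i.e. a vector subbundle of the jet bundle $J_q(E)$. Let $\Phi:J_q(E)\to F_0=J_q(E)/R_q$ be the canonical epimorphism, $F_0$ being a vector bundle of constant rank, and let $\mathcal D=\Phi\circ j_q:E\to F_0$. For a system $R_k\subset J_k(E)$ its $r$-th prolongation $\rho_r(R_k)=R_{k+r}\subset J_{k+r}(E)$ is defined by the equations of $R_k$ and their formal derivatives up to order $r$. The system is *formally integrable* if all $R_{k+r}$, $r\ge0$, are vector bundles and all projections $R_{k+r+1}\to R_{k+r}$ are surjective. Its symbol is $g_k=R_k\cap (S_kT^*\otimes E)$, with algebraic prolongations $g_{k+r}$ (the elements of $S_{k+r}T^*\otimes E$ all of whose $r$-fold contractions with tangent vectors lie in $g_k$). At each point of $X$ let $H^i_{k+r}(g_k)$ be the cohomology at $\wedge^iT^*\otimes g_{k+r}$ of the $\delta$-sequence $\wedge^{i-1}T^*\otimes g_{k+r+1}\to\wedge^iT^*\otimes g_{k+r}\to\wedge^{i+1}T^*\otimes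 S_{k+r-1}T^*\otimes E$ (with $S_{-1}T^*=0$). The symbol $g_k$ is *$p$-acyclic* if $H^1_{k+r}=\dots=H^p_{k+r}=0$ at every point for all $r\ge 0$, and *involutive* if it is $n$-acyclic. The system is *involutive* if it is formally integrable and its symbol is involutive. For $r\ge 0$ let $\rho_r(\Phi):J_{q+r}(E)\to J_r(F_0)$, $j_{q+r}(f)(x)\mapsto j_r(\mathcal Df)(x)$, be the $r$-th prolongation of $\Phi$, and let $B_r=\operatorname{im}\rho_r(\Phi)\subset J_r(F_0)$. A compatibility condition (CC) of order $\le k$ of $\mathcal D$ is a scalar linear differential operator $P$ of order $\le k$ on $F_0$ with $P\circ\mathcal D=0$. The CC of $\mathcal D$ are *generated in order $\le k$* if for every $r\ge0$ the subspace $B_{k+r}\subset J_{k+r}(F_0)$ is, at every point, exactly the set of jets satisfying all CC of order $\le k$ and their formal derivatives up to order $r$. The *generating CC are of order $k$* if $k$ is the least integer with this property. **Theorem.** Let $R_q$ be formally integrable. 1. Suppose that $R_q$ is not involutive and that $g_q$ becomes $2$-acyclic after exactly $s$ prolongations, i.e. $s\ge 0$ is the least integer such that $g_{q+s}$ is $2$-acyclic.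 Then the generating CC of $\mathcal D$ are of order $s+1$. Moreover the system $B_{s+1}\subset J_{s+1}(F_0)$ is formally integrable, and its $r$-th prolongation is $B_{r+s+1}$ for every $r\ge 0$. 2. If $R_q$ is involutive, then the CC of $\mathcal D$ are generated in order $\le 1$, the first order system $B_1\subset J_1(F_0)$ is again involutive, and its $r$-th prolongation is $B_{r+1}$ for every $r\ge0$. (Hence the same applies to the first order operator $\mathcal D_1:F_0\to F_1=J_1(F_0)/B_1$ whenever $F_1$ is a vector bundle of constant rank, and so on: all successive CC operators are first order and involutive.) -/

import Mathlib

open Filter Topology Bundle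
open scoped Manifold ContDiff

namespace FormalPDE

/-! ### Symbols at a point

`V` plays the role of the tangent space `T` at a point, `F` that of the fibre of the bundle, and
`S_k T* ⊗ E` is the space of symmetric `k`-linear maps from `V` to `F`. -/

section Symbols

variable {V F : Type*} [NormedAddCommGroup V] [NormedSpace ℝ V]
  [NormedAddCommGroup F] [NormedSpace ℝ F]

/-- The space `S_k T* ⊗ E` of symmetric tensors. -/
def symTensor (V F : Type*) [NormedAddCommGroup V] [NormedSpace ℝ V]
    [NormedAddCommGroup F] [NormedSpace ℝ F] (k : ℕ) : Submodule ℝ (V [×k]→L[ℝ] F) where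
  carrier := {T | ∀ (σ : Equiv.Perm (Fin k)) (v : Fin k → V), T (v ∘ σ) = T v}
  add_mem' hS hT σ v := by simp [hS σ v, hT σ v]
  zero_mem' σ v := by simp
  smul_mem' c T hT σ v := by simp [hT σ v]

/-- Contraction of a tensor with a vector in the first slot; on coordinates and for the `i`-th basis
vector it is `v_μ ↦ v_{μ+1_i}`. -/
noncomputable def contract {k : ℕ} : V →ₗ[ℝ] (V [×(k + 1)]→L[ℝ] F) →ₗ[ℝ] (V [×k]→L[ℝ] F) :=
  LinearMap.mk₂ ℝ (fun v T => T.curryLeft v)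
    (fun v w T => map_add _ v w) (fun c v T => map_smul _ c v)
    (fun v S T => by ext m; simp) (fun c v T => by ext m; simp)

/-- The first prolongation of a symbol `g ⊆ S_k T* ⊗ E`: the symmetric tensors of order `k + 1`
all of whose contractions lie in `g`. -/
noncomputable def prolongSymbolOne {k : ℕ} (g : Submodule ℝ (V [×k]→L[ℝ] F)) :
    Submodule ℝ (V [×(k + 1)]→L[ℝ] F) :=
  symTensor V F (k + 1) ⊓ ⨅ v : V, g.comap (contract v)

/-- The `r`-th prolongation `g_{k+r}` of a symbol `g = g_k`. -/
noncomputable def prolongSymbol {k : ℕ} (g : Submodule ℝ (V [×k]→L[ℝ] F)) :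
    (r : ℕ) → Submodule ℝ (V [×(k + r)]→L[ℝ] F)
  | 0 => g
  | r + 1 => prolongSymbolOne (prolongSymbol g r)

/-- The map `δ : ⋀^i T* ⊗ S_{k+1} T* ⊗ E → ⋀^{i+1} T* ⊗ S_k T* ⊗ E`,
`(δω)_μ = dx^j ∧ ω_{μ+1_j}`. -/
noncomputable def delta {i k : ℕ} (w : V [⋀^Fin i]→ₗ[ℝ] (V [×(k + 1)]→L[ℝ] F)) :
    V [⋀^Fin (i + 1)]→ₗ[ℝ] (V [×k]→L[ℝ] F) :=
  AlternatingMap.alternatizeUncurryFin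
    { toFun := fun v => (contract v).compAlternatingMap w
      map_add' := fun v w => by ext m; simp
      map_smul' := fun c v => by ext m; simp }

/-- `δω = 0`; on tensors of order `0` the map `δ` is zero, since `S_{-1} T* = 0`. -/
def IsDeltaClosed {i : ℕ} : {k : ℕ} → (V [⋀^Fin i]→ₗ[ℝ] (V [×k]→L[ℝ] F)) → Prop
  | 0, _ => True
  | _ + 1, w => delta w = 0

/-- The symbol `g = g_k` is `p`-acyclic: `H^1_{k+r} = ⋯ = H^p_{k+r} = 0` for all `r ≥ 0`, where
`H^i_{k+r}` is the cohomology of the restricted `δ`-sequence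
`⋀^{i-1} T* ⊗ g_{k+r+1} → ⋀^i T* ⊗ g_{k+r} → ⋀^{i+1} T* ⊗ S_{k+r-1} T* ⊗ E`. -/
def IsAcyclic (p : ℕ) {k : ℕ} (g : Submodule ℝ (V [×k]→L[ℝ] F)) : Prop :=
  ∀ i r : ℕ, i + 1 ≤ p → ∀ w : V [⋀^Fin (i + 1)]→ₗ[ℝ] (V [×(k + r)]→L[ℝ] F),
    (∀ v, w v ∈ prolongSymbol g r) → IsDeltaClosed w →
      ∃ η : V [⋀^Fin i]→ₗ[ℝ] (V [×(k + r + 1)]→L[ℝ] F),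
        (∀ v, η v ∈ prolongSymbol g (r + 1)) ∧ delta η = w

/-- The symbol `g` is involutive: it is `n`-acyclic, with `n = dim T`. -/
def IsInvolutiveSymbol {k : ℕ} (g : Submodule ℝ (V [×k]→L[ℝ] F)) : Prop :=
  IsAcyclic (Module.finrank ℝ V) g

end Symbols

/-! ### Jets of sections of a vector bundle -/

section Jets

variable (V : Type*) [NormedAddCommGroup V] [NormedSpace ℝ V]
  {X : Type*} [TopologicalSpace X] [ChartedSpace V X]
  (F : Type*) [NormedAddCommGroup F] [NormedSpace ℝ F]
  (E : X → Type*) [TopologicalSpace (TotalSpace F E)] [∀ x, TopologicalSpace (E x)]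
  [∀ x, AddCommGroup (E x)] [∀ x, Module ℝ (E x)] [FiberBundle F E] [VectorBundle ℝ F E]

/-- The space of smooth sections of the vector bundle `E` with typical fibre `F` over the manifold
`X` modelled on `V`. -/
abbrev SmoothSection : Type _ := ContMDiffSection 𝓘(ℝ, V) F ∞ E

variable {V F E}

/-- The local representative `V → F` of a section in the chart and the trivialization around `x`. -/
noncomputable def localRep (x : X) (f : SmoothSection V F E) (v : V) : F :=
  (trivializationAt F E x ⟨(chartAt V x).symm v, f ((chartAt V x).symm v)⟩).2

set_option linter.unusedSectionVars false

variable [IsManifold 𝓘(ℝ, V) ∞ X]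

theorem contDiffAt_localRep (x : X) (f : SmoothSection V F E) :
    ContDiffAt ℝ ∞ (localRep x f) (chartAt V x x) := by
  have h := (contMDiffAt_section (IB := 𝓘(ℝ, V)) (n := ∞) x).1 (f.contMDiff x)
  have h2 := h.comp_of_eq (x := chartAt V x x) (g := fun y => (trivializationAt F E x ⟨y, f y⟩).2)
    (f := (chartAt V x).symm) (I := 𝓘(ℝ, V))
    ((contMDiffOn_chart_symm (I := 𝓘(ℝ, V)) (n := ∞) (x := x)).contMDiffAt
      ((chartAt V x).open_target.mem_nhds (mem_chart_target V x)))
    ((chartAt V x).left_inv (mem_chart_source V x))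
  exact contMDiffAt_iff_contDiffAt.1 h2

theorem eventually_mem_baseSet (x : X) :
    ∀ᶠ v in 𝓝 (chartAt V x x), (chartAt V x).symm v ∈ (trivializationAt F E x).baseSet := by
  have hc : ContinuousAt (chartAt V x).symm (chartAt V x x) :=
    (chartAt V x).continuousAt_symm (mem_chart_target V x)
  refine hc.eventually_mem ?_
  rw [(chartAt V x).left_inv (mem_chart_source V x)]
  exact (trivializationAt F E x).open_baseSet.mem_nhds (mem_baseSet_trivializationAt F E x)

/-- The `k`-th derivative at `x` of a section, computed in the chart and the trivialization
around `x`. -/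
noncomputable def derivAt (k : ℕ) (x : X) : SmoothSection V F E →ₗ[ℝ] (V [×k]→L[ℝ] F) where
  toFun f := iteratedFDeriv ℝ k (localRep x f) (chartAt V x x)
  map_add' f g := by
    have hf := (contDiffAt_localRep x f).of_le (m := (k : ℕ∞ω)) (by exact_mod_cast le_top)
    have hg := (contDiffAt_localRep x g).of_le (m := (k : ℕ∞ω)) (by exact_mod_cast le_top)
    have h : localRep x (f + g) =ᶠ[𝓝 (chartAt V x x)] localRep x f + localRep x g := by
      filter_upwards [eventually_mem_baseSet (F := F) (E := E) x] with v hv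
      exact ((trivializationAt F E x).linear ℝ hv).map_add _ _
    rw [(h.iteratedFDeriv ℝ k).eq_of_nhds, iteratedFDeriv_add_apply hf hg]
  map_smul' c f := by
    have hf := (contDiffAt_localRep x f).of_le (m := (k : ℕ∞ω)) (by exact_mod_cast le_top)
    have h : localRep x (c • f) =ᶠ[𝓝 (chartAt V x x)] c • localRep x f := by
      filter_upwards [eventually_mem_baseSet (F := F) (E := E) x] with v hv
      exact ((trivializationAt F E x).linear ℝ hv).map_smul _ _
    rw [(h.iteratedFDeriv ℝ k).eq_of_nhds, iteratedFDeriv_const_smul_apply hf]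
    rfl

/-- The sections all of whose derivatives of order `< m` vanish at `x`. -/
noncomputable def flat (m : ℕ) (x : X) : Submodule ℝ (SmoothSection V F E) :=
  ⨅ i : Fin m, LinearMap.ker (derivAt (i : ℕ) x)

theorem flat_anti {m m' : ℕ} (h : m ≤ m') (x : X) :
    flat m' x ≤ (flat m x : Submodule ℝ (SmoothSection V F E)) :=
  le_iInf fun i => iInf_le_of_le (Fin.castLE h i) le_rfl

variable (V F E) in
/-- The fibre at `x` of the jet bundle `J_k(E)`: smooth sections modulo equality of all derivatives
of order `≤ k` at `x`. -/
abbrev Jet (k : ℕ) (x : X) : Type _ := SmoothSection V F E ⧸ (flat (k + 1) x : Submodule ℝ _)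

/-- The jet `j_k(f)(x)`. -/
noncomputable def jet (k : ℕ) (x : X) : SmoothSection V F E →ₗ[ℝ] Jet V F E k x :=
  (flat (k + 1) x).mkQ

/-- The projection `π^{k+1}_k : J_{k+1}(E) → J_k(E)` at `x`. -/
noncomputable def jetProj (k : ℕ) (x : X) : Jet V F E (k + 1) x →ₗ[ℝ] Jet V F E k x :=
  Submodule.factor (flat_anti (Nat.le_succ _) x)

end Jets

/-! ### Differential operators and systems of partial differential equations -/

section Systems

variable {V : Type*} [NormedAddCommGroup V] [NormedSpace ℝ V]
  {X : Type*} [TopologicalSpace X] [ChartedSpace V X] [IsManifold 𝓘(ℝ, V) ∞ X]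
  {F : Type*} [NormedAddCommGroup F] [NormedSpace ℝ F]
  {E : X → Type*} [TopologicalSpace (TotalSpace F E)] [∀ x, TopologicalSpace (E x)]
  [∀ x, AddCommGroup (E x)] [∀ x, Module ℝ (E x)] [FiberBundle F E] [VectorBundle ℝ F E]
  {F₀ : Type*} [NormedAddCommGroup F₀] [NormedSpace ℝ F₀]
  {E₀ : X → Type*} [TopologicalSpace (TotalSpace F₀ E₀)] [∀ x, TopologicalSpace (E₀ x)]
  [∀ x, AddCommGroup (E₀ x)] [∀ x, Module ℝ (E₀ x)] [FiberBundle F₀ E₀] [VectorBundle ℝ F₀ E₀]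

/-- `D` is a linear differential operator of order `≤ k`, i.e. `D = Φ ∘ j_k` for a bundle map `Φ`
from `J_k(E)` to `E₀`: the value of `D f` at `x` depends only on the `k`-jet of `f` at `x`.
(`Φ` is smooth because `D` maps smooth sections to smooth sections.) -/
def IsDiffOp (k : ℕ) (D : SmoothSection V F E →ₗ[ℝ] SmoothSection V F₀ E₀) : Prop :=
  ∀ (x : X) (f : SmoothSection V F E), jet k x f = 0 → D f x = 0

variable (V F E) in
/-- Linear maps from sections of `E` to smooth functions; those that are differential operators of
order `≤ k` are the linear expressions `a^μ_l(x) y^l_μ` in the jets of order `≤ k`. -/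
abbrev ScalarOp : Type _ := SmoothSection V F E →ₗ[ℝ] SmoothSection V ℝ (Bundle.Trivial X ℝ)

/-- The family of subspaces `R x` of `J_k(E)_x` is a vector subbundle: near every point it is
defined by finitely many pointwise independent smooth linear equations `P τ = 0`. -/
def IsSubbundle {k : ℕ} (R : ∀ x : X, Submodule ℝ (Jet V F E k x)) : Prop :=
  ∀ x : X, ∃ (p : ℕ) (P : Fin p → ScalarOp V F E), (∀ τ, IsDiffOp k (P τ)) ∧
    ∀ᶠ y in 𝓝 x, (∀ f, jet k y f ∈ R y ↔ ∀ τ, P τ f y = 0) ∧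
      ∀ c : Fin p → ℝ, ∃ f, ∀ τ, P τ f y = c τ

/-- `P` is one of the equations (of order `≤ k`) of the system `R`. -/
def IsEquation {k : ℕ} (R : ∀ x : X, Submodule ℝ (Jet V F E k x)) (P : ScalarOp V F E) : Prop :=
  IsDiffOp k P ∧ ∀ (x : X) (f : SmoothSection V F E), jet k x f ∈ R x → P f x = 0

/-- The `r`-th prolongation `ρ_r(R) ⊆ J_{k+r}(E)` of a system `R ⊆ J_k(E)`: it is defined by the
equations of `R` together with their formal derivatives up to order `r`. -/
noncomputable def prolong {k : ℕ} (R : ∀ x : X, Submodule ℝ (Jet V F E k x)) (r : ℕ) (x : X) :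
    Submodule ℝ (Jet V F E (k + r) x) :=
  Submodule.map (jet (k + r) x)
    (⨅ P : {P : ScalarOp V F E // IsEquation R P}, LinearMap.ker (jet r x ∘ₗ P.1))

/-- The symbol of the system `R ⊆ J_k(E)` at `x`: the intersection of `R x` with
`S_k T* ⊗ E ⊆ J_k(E)`, the jets of order `k` whose projection to `J_{k-1}(E)` vanishes. -/
noncomputable def symbol {k : ℕ} (R : ∀ x : X, Submodule ℝ (Jet V F E k x)) (x : X) :
    Submodule ℝ (V [×k]→L[ℝ] F) :=
  Submodule.map (derivAt k x) (flat k x ⊓ (R x).comap (jet k x))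

/-- The system `R` is formally integrable: all its prolongations are vector bundles and the
projections `ρ_{r+1}(R) → ρ_r(R)` are epimorphisms. -/
def IsFormallyIntegrable {k : ℕ} (R : ∀ x : X, Submodule ℝ (Jet V F E k x)) : Prop :=
  ∀ r : ℕ, IsSubbundle (prolong R r) ∧
    ∀ x : X, (prolong R (r + 1) x).map (jetProj (k + r) x) = prolong R r x

/-- The system `R` is involutive: it is formally integrable and its symbol is involutive. -/
def IsInvolutive {k : ℕ} (R : ∀ x : X, Submodule ℝ (Jet V F E k x)) : Prop :=
  IsFormallyIntegrable R ∧ ∀ x : X, IsInvolutiveSymbol (symbol R x)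

/-- The symbol of `R` becomes `p`-acyclic after exactly `s` prolongations. -/
def BecomesAcyclicAfter (p : ℕ) {k : ℕ} (R : ∀ x : X, Submodule ℝ (Jet V F E k x)) (s : ℕ) :
    Prop :=
  IsLeast {t : ℕ | ∀ x : X, IsAcyclic p (prolongSymbol (symbol R x) t)} s

/-- `D = Φ ∘ j_q` where `Φ : J_q(E) → E₀` is an epimorphism of vector bundles with kernel `R`, so
that `E₀ = J_q(E) / R` and `Φ` is the canonical epimorphism. -/
def IsQuotientOperator {q : ℕ} (R : ∀ x : X, Submodule ℝ (Jet V F E q x))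
    (D : SmoothSection V F E →ₗ[ℝ] SmoothSection V F₀ E₀) : Prop :=
  IsDiffOp q D ∧ (∀ (x : X) (f : SmoothSection V F E), jet q x f ∈ R x ↔ D f x = 0) ∧
    ∀ (x : X) (z : E₀ x), ∃ f : SmoothSection V F E, D f x = z

/-- `B_r ⊆ J_r(E₀)`, the image of `ρ_r(Φ) : J_{q+r}(E) → J_r(E₀)`,
`j_{q+r}(f)(x) ↦ j_r(D f)(x)`, where `D = Φ ∘ j_q`. -/
noncomputable def jetImage (D : SmoothSection V F E →ₗ[ℝ] SmoothSection V F₀ E₀) (r : ℕ) (x : X) :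
    Submodule ℝ (Jet V F₀ E₀ r x) :=
  LinearMap.range (jet r x ∘ₗ D)

/-- `P` is a compatibility condition of order `≤ k` of the operator `D`: `P z = 0` whenever
`z = D f`. -/
def IsCC (k : ℕ) (D : SmoothSection V F E →ₗ[ℝ] SmoothSection V F₀ E₀) (P : ScalarOp V F₀ E₀) :
    Prop :=
  IsDiffOp k P ∧ ∀ f : SmoothSection V F E, P (D f) = 0

/-- The compatibility conditions of `D` are generated by those of order `≤ k` (formal exactness):
for every `r`, a jet of order `k + r` is in the image `B_{k+r}` of `J_{q+k+r}(E)` if and only if it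
satisfies the compatibility conditions of order `≤ k` and their formal derivatives up to
order `r`. -/
def CCGeneratedInOrder (k : ℕ) (D : SmoothSection V F E →ₗ[ℝ] SmoothSection V F₀ E₀) : Prop :=
  ∀ (r : ℕ) (x : X) (z : SmoothSection V F₀ E₀),
    jet (k + r) x z ∈ jetImage D (k + r) x ↔
      ∀ P : ScalarOp V F₀ E₀, IsCC k D P → jet r x (P z) = 0

/-- The generating compatibility conditions of `D` are of order (exactly) `k`. -/
def GeneratingCCOrder (D : SmoothSection V F E →ₗ[ℝ] SmoothSection V F₀ E₀) (k : ℕ) : Prop :=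
  IsLeast {l : ℕ | CCGeneratedInOrder l D} k

end Systems

end FormalPDE

/-!
The proof reduces the theorem to linear algebra at a point. Let
`σ_r : S_{q+r} T* ⊗ E → S_r T* ⊗ E₀` be the prolongations of the symbol of `Φ`, with kernels
`g_{q+r}` and images `h_r`. They commute with contractions, hence with `δ`, so that there are short
exact sequences of `δ`-complexes `0 → g → S T* ⊗ E → h → 0`. The complex in the middle is exact by
the Poincaré lemma for polynomial forms (`deltaExact_symTensor`), and the connecting maps identify
`H^{i+1}` of `g` in order `q + r` with `H^i` of `h` in order `r + 1`, for `i ≥ 1`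
(`SymbolFamily.deltaExact_kernel`, `SymbolFamily.deltaExact_image`). As `H^1` of `g` always
vanishes, `g_{q+s}` is 2-acyclic if and only if `H^1` of `h` vanishes in orders `≥ s + 1`, which
means that `h_{r+1}` is the prolongation of `h_r` for all `r ≥ s + 1`.

Formal integrability of `R` makes `h_r` the symbol of `B_r` for `r ≥ 1`
(`IsQuotientOperator.symbol_jetImage`), and makes `B_r` a vector bundle
(`isSubbundle_jetImage`), being the quotient of `J_{q+r}(E)` by the vector bundle `R_{q+r}`. So if
`H^1` of `h` vanishes in orders `≥ k` with `k ≥ 1`, an induction on the order, correcting a jet by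
an element of `h`, shows that the compatibility conditions are generated in order `≤ k`
(`IsQuotientOperator.exists_of_forall_isCC`). This means that the prolongations of `B_k` are the
`B_{k+r}`, and these project onto each other because the jet spaces `J_{q+k+r}(E)` do. Conversely,
if the compatibility conditions are generated in order `≤ l`, then a symmetric tensor whose
contractions lie in `h_r` satisfies the formal derivatives of the conditions, hence lies in
`h_{r+1}`, for `r ≥ max l 1` (`IsQuotientOperator.deltaExact_image_of_cCGenerated`). If `l = 0`,
there are no conditions as `D` takes all values at a point; then all `σ_r` are onto and `g` is
involutive. If `R` is involutive, all cohomology of `g` vanishes, hence that of `h` in orders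
`≥ 1`, and `B_1` is involutive.

Jets are classes of global sections, so all statements are about sections vanishing to a given order
at a point (`flat`). Two facts translate between sections and tensors: a differential operator of
order `≤ k` lowers the order of vanishing by at most `k` (`IsDiffOp.map_mem_flat`), and commutes
with directional derivatives modulo operators of order `≤ k` (`IsDiffOp.commutator_mem_flat`). Both
follow from its expression in coordinates (`IsDiffOp.exists_local_expression`).
-/

namespace FormalPDE

/-! ### The `δ`-complex of symmetric tensors -/

section SpencerComplex

variable {V F : Type*} [NormedAddCommGroup V] [NormedSpace ℝ V]
  [NormedAddCommGroup F] [NormedSpace ℝ F]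

theorem contract_apply {k : ℕ} (v : V) (T : V [×(k + 1)]→L[ℝ] F) (m : Fin k → V) :
    contract v T m = T (Fin.cons v m) := rfl

theorem eq_zero_of_contract_eq_zero {k : ℕ} {T : V [×(k + 1)]→L[ℝ] F}
    (h : ∀ v, contract v T = 0) : T = 0 := by
  ext m
  rw [← Fin.cons_self_tail m, ← contract_apply, h]
  simp

theorem eq_of_contract_eq {k : ℕ} {S T : V [×(k + 1)]→L[ℝ] F}
    (h : ∀ v, contract v S = contract v T) : S = T :=
  sub_eq_zero.1 (eq_zero_of_contract_eq_zero fun v => by rw [map_sub, h, sub_self])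

/-- A map that is symmetric in all slots but the first is invariant under all permutations fixing
the first slot. -/
theorem apply_comp_of_map_zero {V F : Type*} {n : ℕ} {T : (Fin (n + 1) → V) → F}
    (h : ∀ (ρ : Equiv.Perm (Fin n)) (a : V) (u : Fin n → V),
      T (Fin.cons a (u ∘ ρ)) = T (Fin.cons a u))
    (ρ : Equiv.Perm (Fin (n + 1))) (hρ : ρ 0 = 0) (u : Fin (n + 1) → V) : T (u ∘ ρ) = T u := by
  obtain ⟨⟨p, e⟩, rfl⟩ := Equiv.Perm.decomposeFin.symm.surjective ρ
  rw [Equiv.Perm.decomposeFin_symm_apply_zero] at hρ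
  subst hρ
  conv_rhs => rw [← Fin.cons_self_tail u]
  rw [← h e]
  congr 1
  ext j
  refine Fin.cases ?_ (fun j => ?_) j
  · simp
  · simp [Fin.tail]

/-- Every permutation is a cycle bringing one index to the front followed by a permutation of the
remaining indices. -/
theorem apply_comp_mul_cycleRange_symm {V F : Type*} {n : ℕ} {T : (Fin (n + 1) → V) → F}
    (h : ∀ (ρ : Equiv.Perm (Fin n)) (a : V) (u : Fin n → V),
      T (Fin.cons a (u ∘ ρ)) = T (Fin.cons a u))
    (σ : Equiv.Perm (Fin (n + 1))) (j : Fin (n + 1)) (u : Fin (n + 1) → V) :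
    T (u ∘ (σ * j.cycleRange⁻¹ : Equiv.Perm (Fin (n + 1)))) = T (u ∘ (σ j).cycleRange.symm) := by
  have := apply_comp_of_map_zero h ((σ j).cycleRange * (σ * j.cycleRange⁻¹)) ?_
    (u ∘ (σ j).cycleRange.symm)
  · rw [← this]
    congr 1
    ext i
    simp
  · have h0 : j.cycleRange⁻¹ 0 = j := by rw [Equiv.Perm.inv_eq_iff_eq, Fin.cycleRange_self]
    simp [Equiv.Perm.mul_apply, h0]

/-- A tensor is symmetric as soon as it is symmetric in all slots but the first and in the first
two. -/
theorem mem_symTensor_of_contract {n : ℕ} {T : V [×(n + 2)]→L[ℝ] F}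
    (h : ∀ v, contract v T ∈ symTensor V F (n + 1))
    (hs : ∀ a b, contract a (contract b T) = contract b (contract a T)) :
    T ∈ symTensor V F (n + 2) := by
  have ht : ∀ (ρ : Equiv.Perm (Fin (n + 1))) (a : V) (u : Fin (n + 1) → V),
      T (Fin.cons a (u ∘ ρ)) = T (Fin.cons a u) := fun ρ a u => h a ρ u
  have hc : ∀ (j : Fin (n + 2)) (u : Fin (n + 2) → V), T (u ∘ j.cycleRange.symm) = T u := by
    intro j u
    rw [← Fin.cons_removeNth_eq_comp_cycleRange_symm]
    refine Fin.cases ?_ (fun i => ?_) j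
    · rw [Fin.removeNth_zero, Fin.cons_self_tail]
    · have e1 : (i.succ.removeNth u : Fin (n + 1) → V) =
          Fin.cons (u 0) (i.removeNth (Fin.tail u)) := by
        ext k
        refine Fin.cases ?_ (fun k => ?_) k
        · simp [Fin.removeNth]
        · simp [Fin.removeNth, Fin.tail]
      rw [e1]
      refine (congrArg (fun S => S (i.removeNth (Fin.tail u))) (hs (u 0) (u i.succ))).trans ?_
      have e3 : (Fin.cons (u i.succ) (i.removeNth (Fin.tail u)) : Fin (n + 1) → V) =
          Fin.tail u ∘ i.cycleRange.symm :=
        Fin.cons_removeNth_eq_comp_cycleRange_symm (Fin.tail u) i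
      rw [contract_apply, contract_apply, e3, ht, Fin.cons_self_tail]
  intro σ u
  have := apply_comp_mul_cycleRange_symm (T := T) ht σ 0 u
  rw [hc] at this
  rw [← this]
  congr 1
  ext i
  simp [Fin.cycleRange_zero]

theorem symTensor_eq_top_of_le_one {n : ℕ} (hn : n ≤ 1) : symTensor V F n = ⊤ := by
  have : Subsingleton (Fin n) := by
    rcases Nat.le_one_iff_eq_zero_or_eq_one.1 hn with rfl | rfl <;> infer_instance
  refine eq_top_iff.2 fun T _ σ v => ?_
  rw [Subsingleton.elim σ 1]
  rfl

theorem contract_mem_symTensor {k : ℕ} {T : V [×(k + 1)]→L[ℝ] F} (hT : T ∈ symTensor V F (k + 1))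
    (v : V) : contract v T ∈ symTensor V F k := by
  intro σ u
  rw [contract_apply, contract_apply,
    ← hT (Equiv.Perm.decomposeFin.symm (0, σ)) (Fin.cons v u)]
  congr 1
  ext j
  refine Fin.cases ?_ (fun j => ?_) j
  · simp
  · simp

theorem contract_comm {k : ℕ} {T : V [×(k + 2)]→L[ℝ] F} (hT : T ∈ symTensor V F (k + 2))
    (v w : V) : contract v (contract w T) = contract w (contract v T) := by
  ext m
  simp only [contract_apply]
  rw [← hT (Equiv.swap 0 1) (Fin.cons v (Fin.cons w m))]
  congr 1
  ext j
  refine Fin.cases ?_ (fun j => Fin.cases ?_ (fun j => ?_) j) j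
  · simp
  · simp
  · have : Equiv.swap (0 : Fin (k + 2)) 1 j.succ.succ = j.succ.succ := by
      apply Equiv.swap_apply_of_ne_of_ne
      · simp
      · rw [← Fin.succ_zero_eq_one, Ne, Fin.succ_inj]
        exact Fin.succ_ne_zero j
    simp [this]

theorem delta_apply {i k : ℕ} (w : V [⋀^Fin i]→ₗ[ℝ] (V [×(k + 1)]→L[ℝ] F))
    (v : Fin (i + 1) → V) :
    delta w v = ∑ a : Fin (i + 1), (-1) ^ (a : ℕ) • contract (v a) (w (a.removeNth v)) := by
  rw [delta, AlternatingMap.alternatizeUncurryFin_apply]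
  rfl

theorem delta_sub {i k : ℕ} (w w' : V [⋀^Fin i]→ₗ[ℝ] (V [×(k + 1)]→L[ℝ] F)) :
    delta (w - w') = delta w - delta w' := by
  ext1 v
  simp [delta_apply, smul_sub, Finset.sum_sub_distrib]

theorem delta_smul {i k : ℕ} (c : ℝ) (w : V [⋀^Fin i]→ₗ[ℝ] (V [×(k + 1)]→L[ℝ] F)) :
    delta (c • w) = c • delta w := by
  ext1 v
  simp [delta_apply, Finset.smul_sum, smul_comm c]

theorem delta_mem {i k : ℕ} {w : V [⋀^Fin i]→ₗ[ℝ] (V [×(k + 1)]→L[ℝ] F)}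
    {G : Submodule ℝ (V [×k]→L[ℝ] F)} (h : ∀ u v, contract u (w v) ∈ G) (v : Fin (i + 1) → V) :
    delta w v ∈ G := by
  rw [delta_apply]
  exact Submodule.sum_mem _ fun a _ => by
    rcases neg_one_pow_eq_or ℤ (a : ℕ) with h' | h' <;> rw [h']
    · simpa using h _ _
    · simpa using h _ _

theorem delta_delta {i k : ℕ} {w : V [⋀^Fin i]→ₗ[ℝ] (V [×(k + 2)]→L[ℝ] F)}
    (hw : ∀ v, w v ∈ symTensor V F (k + 2)) : delta (delta w) = 0 := by
  have := AlternatingMap.alternatizeUncurryFin_alternatizeUncurryFinLM_comp_of_symmetric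
    (f := LinearMap.mk₂ ℝ (fun x y => (contract x ∘ₗ contract y).compAlternatingMap w)
      (fun x y z => by ext; simp) (fun x y z => by ext; simp) (fun x y z => by ext; simp)
      (fun x y z => by ext; simp)) (fun x y => by
        ext1 v
        exact contract_comm (hw v) x y)
  rw [← this]
  unfold delta
  congr 1
  ext1 x
  ext1 v
  simp only [LinearMap.coe_mk, AddHom.coe_mk, LinearMap.compAlternatingMap_apply,
    AlternatingMap.alternatizeUncurryFin_apply, map_sum, LinearMap.coe_comp, Function.comp_apply,
    AlternatingMap.alternatizeUncurryFinLM_apply, LinearMap.mk₂_apply, map_zsmul]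

theorem isDeltaClosed_delta {i : ℕ} : ∀ {k : ℕ} {w : V [⋀^Fin i]→ₗ[ℝ] (V [×(k + 1)]→L[ℝ] F)},
    (∀ v, w v ∈ symTensor V F (k + 1)) → IsDeltaClosed (delta w)
  | 0, _, _ => trivial
  | _ + 1, _, hw => delta_delta hw

/-- Vanishing of the cohomology at `⋀^{i+1} T* ⊗ G_m` of the `δ`-sequence restricted to a graded
family `G` of spaces of tensors. -/
def DeltaExact (G : ∀ m, Submodule ℝ (V [×m]→L[ℝ] F)) (i m : ℕ) : Prop :=
  ∀ w : V [⋀^Fin (i + 1)]→ₗ[ℝ] (V [×m]→L[ℝ] F), (∀ v, w v ∈ G m) → IsDeltaClosed w →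
    ∃ η : V [⋀^Fin i]→ₗ[ℝ] (V [×(m + 1)]→L[ℝ] F), (∀ v, η v ∈ G (m + 1)) ∧ delta η = w

theorem deltaExact_of_finrank_lt [FiniteDimensional ℝ V] (G : ∀ m, Submodule ℝ (V [×m]→L[ℝ] F))
    {i m : ℕ} (h : Module.finrank ℝ V < i + 1) : DeltaExact G i m := by
  intro w _ _
  refine ⟨0, fun v => by simp, ?_⟩
  have : w = 0 := by
    ext1 v
    refine AlternatingMap.map_linearDependent _ _ fun hv => ?_
    have := hv.fintype_card_le_finrank
    simp at this
    omega
  rw [this]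
  ext1 v
  simp [delta_apply]

/-- Contracting an alternating form of degree `i + 1` with the position vector and multiplying it
again by the differential of that vector gives `i + 1` times the form. -/
theorem sum_neg_one_pow_cons_removeNth {i m : ℕ} (w : V [⋀^Fin (i + 1)]→ₗ[ℝ] (V [×m]→L[ℝ] F))
    (v : Fin (i + 1) → V) :
    ∑ a : Fin (i + 1), (-1) ^ (a : ℕ) • w (Fin.cons (v a) (a.removeNth v)) =
      ((i : ℝ) + 1) • w v := by
  have := congrArg (· v) (AlternatingMap.alternatizeUncurryFin_curryLeft w)
  simp only [AlternatingMap.alternatizeUncurryFin_apply] at this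
  refine Eq.trans this ?_
  simp [add_smul, Nat.cast_smul_eq_nsmul]

section Poincare

variable [FiniteDimensional ℝ V]

/-- The form `v ↦ w (·, v)(·, …, ·)`, with values in tensors of one order more that need not be
symmetric in their first slot. -/
noncomputable def shiftSlot {i m : ℕ} (w : V [⋀^Fin (i + 1)]→ₗ[ℝ] (V [×m]→L[ℝ] F)) :
    V [⋀^Fin i]→ₗ[ℝ] (V [×(m + 1)]→L[ℝ] F) where
  toFun v := ((LinearMap.toContinuousLinearMap
    { toFun := fun u => w (Fin.cons u v)
      map_add' := fun a b => by
        have := w.toMultilinearMap.cons_add v a b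
        exact this
      map_smul' := fun c a => by
        have := w.toMultilinearMap.cons_smul v c a
        exact this } : V →L[ℝ] (V [×m]→L[ℝ] F))).uncurryLeft
  map_update_add' v j a b := by
    ext u
    have key : ∀ c : V, (Fin.cons (u 0) (Function.update v j c) : Fin (i + 1) → V) =
        Function.update (Fin.cons (u 0) v) j.succ c := fun c => by
      rw [← Fin.cons_update]; congr!
    simp [key]
  map_update_smul' v j c a := by
    ext u
    have key : ∀ c : V, (Fin.cons (u 0) (Function.update v j c) : Fin (i + 1) → V) =
        Function.update (Fin.cons (u 0) v) j.succ c := fun c => by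
      rw [← Fin.cons_update]; congr!
    simp [key]
  map_eq_zero_of_eq' v j k h hjk := by
    ext u
    have : w (Fin.cons (u 0) v) = 0 := w.map_eq_zero_of_eq _ (i := j.succ) (j := k.succ)
      (by simpa using h) (by simpa using hjk)
    simp [this]

theorem shiftSlot_apply {i m : ℕ} (w : V [⋀^Fin (i + 1)]→ₗ[ℝ] (V [×m]→L[ℝ] F)) (v : Fin i → V)
    (u : Fin (m + 1) → V) : shiftSlot w v u = w (Fin.cons (u 0) v) (Fin.tail u) := rfl

/-- The homotopy operator `(h w)(v)(u_0, …, u_m) = ∑_j w(u_j, v)(u_0, …, û_j, …, u_m)` of the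
`δ`-complex of all symmetric tensors. -/
noncomputable def homotopyOp {i m : ℕ} (w : V [⋀^Fin (i + 1)]→ₗ[ℝ] (V [×m]→L[ℝ] F)) :
    V [⋀^Fin i]→ₗ[ℝ] (V [×(m + 1)]→L[ℝ] F) :=
  (∑ j : Fin (m + 1), (LinearMap.mk ⟨fun T : V [×(m + 1)]→L[ℝ] F =>
    ContinuousMultilinearMap.domDomCongr j.cycleRange.symm T, fun _ _ => rfl⟩ (fun _ _ => rfl) :
      (V [×(m + 1)]→L[ℝ] F) →ₗ[ℝ] (V [×(m + 1)]→L[ℝ] F))).compAlternatingMap (shiftSlot w)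

theorem homotopyOp_apply {i m : ℕ} (w : V [⋀^Fin (i + 1)]→ₗ[ℝ] (V [×m]→L[ℝ] F)) (v : Fin i → V)
    (u : Fin (m + 1) → V) :
    homotopyOp w v u = ∑ j : Fin (m + 1), shiftSlot w v (u ∘ j.cycleRange.symm) := by
  rw [homotopyOp, LinearMap.compAlternatingMap_apply, LinearMap.sum_apply, sum_apply]
  rfl

theorem homotopyOp_apply_removeNth {i m : ℕ} (w : V [⋀^Fin (i + 1)]→ₗ[ℝ] (V [×m]→L[ℝ] F))
    (v : Fin i → V) (u : Fin (m + 1) → V) :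
    homotopyOp w v u = ∑ j : Fin (m + 1), w (Fin.cons (u j) v) (j.removeNth u) := by
  rw [homotopyOp_apply]
  refine Finset.sum_congr rfl fun j _ => ?_
  rw [← Fin.cons_removeNth_eq_comp_cycleRange_symm, shiftSlot_apply]
  simp

theorem homotopyOp_mem_symTensor {i m : ℕ} {w : V [⋀^Fin (i + 1)]→ₗ[ℝ] (V [×m]→L[ℝ] F)}
    (hw : ∀ v, w v ∈ symTensor V F m) (v : Fin i → V) :
    homotopyOp w v ∈ symTensor V F (m + 1) := by
  intro σ u
  rw [homotopyOp_apply, homotopyOp_apply,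
    ← Equiv.sum_comp σ fun j => shiftSlot w v (u ∘ j.cycleRange.symm)]
  refine Finset.sum_congr rfl fun j _ => ?_
  refine Eq.trans ?_ (apply_comp_mul_cycleRange_symm (T := shiftSlot w v) (fun ρ a u => ?_) σ j u)
  · rfl
  simp only [shiftSlot_apply, Fin.cons_zero, Fin.tail_cons]
  exact hw _ ρ u

/-- Euler's formula: on closed forms `δ h` is multiplication by the total degree, since `h` is the
contraction with the position vector field once symmetric tensors are read as polynomials. -/
theorem delta_homotopyOp {i m : ℕ} {w : V [⋀^Fin (i + 1)]→ₗ[ℝ] (V [×m]→L[ℝ] F)}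
    (hs : ∀ v, w v ∈ symTensor V F m) (hw : IsDeltaClosed w) :
    delta (homotopyOp w) = ((i : ℝ) + 1 + m) • w := by
  ext v u
  have h1 : delta (homotopyOp w) v u = ∑ a : Fin (i + 1), (-1) ^ (a : ℕ) •
      (w (Fin.cons (v a) (a.removeNth v)) u +
        ∑ j : Fin m, w (Fin.cons (u j) (a.removeNth v))
          (j.succ.removeNth (Fin.cons (v a) u : Fin (m + 1) → V))) := by
    rw [delta_apply, sum_apply]
    refine Finset.sum_congr rfl fun a _ => ?_
    rw [smul_apply, contract_apply, homotopyOp_apply_removeNth, Fin.sum_univ_succ]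
    simp
  have h2 : ∀ j : Fin m, ∑ a : Fin (i + 1), (-1) ^ (a : ℕ) •
      w (Fin.cons (u j) (a.removeNth v))
        (j.succ.removeNth (Fin.cons (v a) u : Fin (m + 1) → V)) = w v u := by
    intro j
    -- The equation `δ w = 0`, evaluated at `u_j, v` and at the remaining arguments of `u`.
    cases m with
    | zero => exact j.elim0
    | succ m =>
      have hw' : delta w (Fin.cons (u j) v) = 0 := by
        rw [show delta w = 0 from hw]; rfl
      have h3 := congrArg (fun T => T (j.removeNth u)) hw'
      simp only [delta_apply, Fin.sum_univ_succ (n := i + 1), add_apply,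
        sum_apply, smul_apply,
        contract_apply, zero_apply] at h3
      have h4 : w v (Fin.cons (u j) (j.removeNth u)) = w v u := by
        rw [Fin.cons_removeNth_eq_comp_cycleRange_symm]
        exact hs v _ u
      simp only [Fin.val_zero, pow_zero, one_smul, Fin.cons_zero, Fin.removeNth_zero,
        Fin.tail_cons, h4] at h3
      rw [eq_comm, ← sub_eq_zero, ← h3, sub_eq_add_neg, ← Finset.sum_neg_distrib]
      congr 1
      refine Finset.sum_congr rfl fun a _ => ?_
      have e1 : (j.succ.removeNth (Fin.cons (v a) u : Fin (m + 2) → V) : Fin (m + 1) → V) =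
          Fin.cons (v a) (j.removeNth u) := by
        ext k
        refine Fin.cases ?_ (fun k => ?_) k
        · simp [Fin.removeNth]
        · simp [Fin.removeNth]
      have e2 : (a.succ.removeNth (Fin.cons (u j) v : Fin (i + 2) → V) : Fin (i + 1) → V) =
          Fin.cons (u j) (a.removeNth v) := by
        ext k
        refine Fin.cases ?_ (fun k => ?_) k
        · simp [Fin.removeNth]
        · simp [Fin.removeNth]
      rw [e1, e2]
      simp [pow_succ]
  rw [h1]
  simp only [smul_add, Finset.sum_add_distrib, Finset.smul_sum]
  rw [Finset.sum_comm, Finset.sum_congr rfl fun j _ => h2 j]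
  have h5 := congrArg (fun T => T u) (sum_neg_one_pow_cons_removeNth w v)
  simp only [sum_apply, smul_apply] at h5
  rw [h5]
  simp [add_smul, Nat.cast_smul_eq_nsmul]

/-- The Poincaré lemma for polynomial forms: the `δ`-complex of all symmetric tensors is exact. -/
theorem deltaExact_symTensor (i m : ℕ) : DeltaExact (symTensor V F) i m := by
  intro w hs hw
  have h0 : ((i : ℝ) + 1 + m) ≠ 0 := by positivity
  refine ⟨((i : ℝ) + 1 + m)⁻¹ • homotopyOp w,
    fun v => Submodule.smul_mem _ _ (homotopyOp_mem_symTensor hs v), ?_⟩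
  rw [delta_smul, delta_homotopyOp hs hw, smul_smul, inv_mul_cancel₀ h0, one_smul]

end Poincare

end SpencerComplex

/-! ### Kernels and images of prolonged symbols -/

section KernelImage

variable {V F F₀ : Type*} [NormedAddCommGroup V] [NormedSpace ℝ V]
  [NormedAddCommGroup F] [NormedSpace ℝ F] [NormedAddCommGroup F₀] [NormedSpace ℝ F₀]

theorem mem_prolongSymbolOne {k : ℕ} {g : Submodule ℝ (V [×k]→L[ℝ] F)} {T : V [×(k + 1)]→L[ℝ] F} :
    T ∈ prolongSymbolOne g ↔ T ∈ symTensor V F (k + 1) ∧ ∀ v, contract v T ∈ g := by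
  simp [prolongSymbolOne]

theorem DeltaExact.of_eq {G G' : ∀ m, Submodule ℝ (V [×m]→L[ℝ] F)} {i m : ℕ}
    (h : DeltaExact G i m) (h0 : G m = G' m) (h1 : G (m + 1) = G' (m + 1)) : DeltaExact G' i m := by
  rw [DeltaExact, ← h0, ← h1]
  exact h

theorem alternatingMap_fin_zero_delta {m : ℕ} (η : V [⋀^Fin 0]→ₗ[ℝ] (V [×(m + 1)]→L[ℝ] F))
    (v : Fin 1 → V) (u : Fin 0 → V) : delta η v = contract (v 0) (η u) := by
  rw [delta_apply, Fin.sum_univ_one, Subsingleton.elim (Fin.removeNth 0 v) u]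
  simp

/-- Exactness at `T* ⊗ G_m` means that `G_{m+1}` contains the prolongation of `G_m`. -/
theorem deltaExact_zero_iff [FiniteDimensional ℝ V] {G : ∀ m, Submodule ℝ (V [×m]→L[ℝ] F)} {m : ℕ}
    (hG : G m ≤ symTensor V F m) : DeltaExact G 0 m ↔ prolongSymbolOne (G m) ≤ G (m + 1) := by
  constructor
  · intro h T hT
    obtain ⟨hTs, hTc⟩ := mem_prolongSymbolOne.1 hT
    let τ : V [⋀^Fin 0]→ₗ[ℝ] (V [×(m + 1)]→L[ℝ] F) := AlternatingMap.constOfIsEmpty ℝ V _ T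
    have hτ : ∀ v, τ v = T := fun v => rfl
    obtain ⟨η, hη, hd⟩ := h (delta τ)
      (fun v => by rw [alternatingMap_fin_zero_delta τ v Fin.elim0, hτ]; exact hTc _)
      (isDeltaClosed_delta fun v => by rw [hτ]; exact hTs)
    have : η Fin.elim0 = T := eq_of_contract_eq fun v => by
      have := congrArg (fun w => w fun _ => v) hd
      simpa [alternatingMap_fin_zero_delta _ (fun _ => v) Fin.elim0, hτ] using this
    rw [← this]
    exact hη _
  · intro h w hw hc
    obtain ⟨η, hη, hd⟩ := deltaExact_symTensor 0 m w (fun v => hG (hw v)) hc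
    refine ⟨η, fun u => h (mem_prolongSymbolOne.2 ⟨hη u, fun v => ?_⟩), hd⟩
    rw [← alternatingMap_fin_zero_delta η (fun _ => v) u, hd]
    exact hw _

/-- A linear map onto a subspace admits a linear section over it. -/
theorem exists_linear_section {M N : Type*} [AddCommGroup M] [Module ℝ M] [AddCommGroup N]
    [Module ℝ N] (f : M →ₗ[ℝ] N) (S : Submodule ℝ M) :
    ∃ g : N →ₗ[ℝ] M, ∀ y ∈ S.map f, g y ∈ S ∧ f (g y) = y := by
  have hr : LinearMap.range (f.submoduleMap S) = ⊤ :=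
    LinearMap.range_eq_top.2 (f.submoduleMap_surjective S)
  obtain ⟨g₀, hg₀⟩ := (f.submoduleMap S).exists_rightInverse_of_surjective hr
  obtain ⟨g, hg⟩ := LinearMap.exists_extend (S.subtype ∘ₗ g₀)
  refine ⟨g, fun y hy => ?_⟩
  have h1 : g y = g₀ ⟨y, hy⟩ := congrArg (fun l => l ⟨y, hy⟩) hg
  rw [h1]
  refine ⟨(g₀ ⟨y, hy⟩).2, ?_⟩
  exact congrArg (fun l => ((l ⟨y, hy⟩ : S.map f) : N)) hg₀

theorem delta_compAlternatingMap {i k l : ℕ}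
    {L : (V [×(k + 1)]→L[ℝ] F) →ₗ[ℝ] (V [×(l + 1)]→L[ℝ] F₀)}
    {L' : (V [×k]→L[ℝ] F) →ₗ[ℝ] (V [×l]→L[ℝ] F₀)} {w : V [⋀^Fin i]→ₗ[ℝ] (V [×(k + 1)]→L[ℝ] F)}
    (h : ∀ u v, contract u (L (w v)) = L' (contract u (w v))) :
    delta (L.compAlternatingMap w) = L'.compAlternatingMap (delta w) := by
  ext1 v
  simp [delta_apply, h]

/-- A family of maps `σ_r : S_{q+r} T* ⊗ F → S_r T* ⊗ F₀` commuting with contractions, as are the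
prolongations of the symbol of a linear differential operator of order `q`. -/
structure SymbolFamily (V F F₀ : Type*) [NormedAddCommGroup V] [NormedSpace ℝ V]
    [NormedAddCommGroup F] [NormedSpace ℝ F] [NormedAddCommGroup F₀] [NormedSpace ℝ F₀]
    (q : ℕ) where
  /-- The map on tensors of order `q + r`. -/
  map (r : ℕ) : (V [×(q + r)]→L[ℝ] F) →ₗ[ℝ] (V [×r]→L[ℝ] F₀)
  map_mem (r : ℕ) {T : V [×(q + r)]→L[ℝ] F} : T ∈ symTensor V F (q + r) →
    map r T ∈ symTensor V F₀ r
  contract_map (r : ℕ) {T : V [×(q + (r + 1))]→L[ℝ] F} (v : V) :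
    T ∈ symTensor V F (q + (r + 1)) → contract v (map (r + 1) T) = map r (contract (k := q + r) v T)

namespace SymbolFamily

variable {q : ℕ} (σ : SymbolFamily V F F₀ q)

/-- The image of `σ_r`. -/
def image (r : ℕ) : Submodule ℝ (V [×r]→L[ℝ] F₀) := (symTensor V F (q + r)).map (σ.map r)

theorem image_le (r : ℕ) : σ.image r ≤ symTensor V F₀ r := by
  rintro _ ⟨T, hT, rfl⟩
  exact σ.map_mem r hT

theorem image_le_prolongSymbolOne (r : ℕ) : σ.image (r + 1) ≤ prolongSymbolOne (σ.image r) := by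
  rintro _ ⟨T, hT, rfl⟩
  refine mem_prolongSymbolOne.2 ⟨σ.map_mem _ hT, fun v => ⟨_, contract_mem_symTensor hT v, ?_⟩⟩
  exact (σ.contract_map r v hT).symm

/-- The family `G` of tensors is, in orders `≥ q`, the family of the kernels of the `σ_r`. -/
def IsKernel (G : ∀ m, Submodule ℝ (V [×m]→L[ℝ] F)) : Prop :=
  ∀ r T, T ∈ G (q + r) ↔ T ∈ symTensor V F (q + r) ∧ σ.map r T = 0

variable {σ} {G : ∀ m, Submodule ℝ (V [×m]→L[ℝ] F)} [FiniteDimensional ℝ V]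

/-- `H^{i+2}_{q+r}` of the kernels vanishes if `H^{i+1}_{r+1}` of the images does: the connecting
map of the short exact sequence of kernels, symmetric tensors and images is an isomorphism, as the
`δ`-cohomology of the symmetric tensors is zero. -/
theorem deltaExact_kernel (hG : σ.IsKernel G) {i r : ℕ} (h : DeltaExact σ.image i (r + 1)) :
    DeltaExact G (i + 1) (q + r) := by
  intro w hw hc
  obtain ⟨η, hη, hd⟩ := deltaExact_symTensor (i + 1) (q + r) w (fun v => ((hG r _).1 (hw v)).1) hc
  have e1 : delta ((σ.map (r + 1)).compAlternatingMap η) = (σ.map r).compAlternatingMap (delta η) :=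
    delta_compAlternatingMap fun u v => σ.contract_map r u (hη v)
  obtain ⟨ζ, hζ, hdζ⟩ := h ((σ.map (r + 1)).compAlternatingMap η) (fun v => ⟨_, hη v, rfl⟩) (by
    change delta _ = 0
    rw [e1, hd]
    ext1 v
    exact ((hG r _).1 (hw v)).2)
  -- Correct the primitive `η` of `w` by the coboundary of a lift of `ζ`, to land in the kernel.
  obtain ⟨g, hg⟩ := exists_linear_section (σ.map (r + 2)) (symTensor V F (q + (r + 2)))
  let ξ : V [⋀^Fin i]→ₗ[ℝ] (V [×(q + (r + 2))]→L[ℝ] F) := g.compAlternatingMap ζ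
  have hξ : ∀ v, ξ v ∈ symTensor V F (q + (r + 2)) := fun v => (hg _ (hζ v)).1
  have hσξ : (σ.map (r + 2)).compAlternatingMap ξ = ζ := by
    ext1 v
    exact (hg _ (hζ v)).2
  have e2 : delta ((σ.map (r + 2)).compAlternatingMap ξ) =
      (σ.map (r + 1)).compAlternatingMap (delta (k := q + (r + 1)) ξ) :=
    delta_compAlternatingMap fun u v => σ.contract_map (r + 1) u (hξ v)
  rw [hσξ, hdζ] at e2
  refine ⟨η - delta (k := q + (r + 1)) ξ, fun v => (hG (r + 1) _).2 ⟨?_, ?_⟩, ?_⟩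
  · exact Submodule.sub_mem _ (hη v)
      (delta_mem (fun u v => contract_mem_symTensor (hξ v) u) v)
  · have := congrArg (fun f => f v) e2
    simp only [LinearMap.compAlternatingMap_apply] at this
    rw [AlternatingMap.sub_apply, map_sub, this, sub_self]
  · rw [delta_sub, hd, delta_delta (k := q + r) hξ, sub_zero]

/-- `H^{i+1}_{r+1}` of the images vanishes if `H^{i+2}_{q+r}` of the kernels does. -/
theorem deltaExact_image (hG : σ.IsKernel G) {i r : ℕ} (h : DeltaExact G (i + 1) (q + r)) :
    DeltaExact σ.image i (r + 1) := by
  intro w hw hc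
  obtain ⟨g, hg⟩ := exists_linear_section (σ.map (r + 1)) (symTensor V F (q + (r + 1)))
  let ξ : V [⋀^Fin (i + 1)]→ₗ[ℝ] (V [×(q + (r + 1))]→L[ℝ] F) := g.compAlternatingMap w
  have hξ : ∀ v, ξ v ∈ symTensor V F (q + (r + 1)) := fun v => (hg _ (hw v)).1
  have hσξ : (σ.map (r + 1)).compAlternatingMap ξ = w := by
    ext1 v
    exact (hg _ (hw v)).2
  have e1 : delta ((σ.map (r + 1)).compAlternatingMap ξ) =
      (σ.map r).compAlternatingMap (delta (k := q + r) ξ) :=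
    delta_compAlternatingMap fun u v => σ.contract_map r u (hξ v)
  rw [hσξ, show delta w = 0 from hc] at e1
  obtain ⟨η, hη, hd⟩ := h (delta (k := q + r) ξ)
    (fun v => (hG r _).2 ⟨delta_mem (fun u v => contract_mem_symTensor (hξ v) u) v,
      (congrArg (fun f => f v) e1).symm⟩) (isDeltaClosed_delta (k := q + r) hξ)
  -- The lift `ξ` of `w` becomes closed after subtracting a form with values in the kernel.
  obtain ⟨θ, hθ, hdθ⟩ := deltaExact_symTensor i (q + (r + 1)) (ξ - η)
    (fun v => Submodule.sub_mem _ (hξ v) ((hG (r + 1) _).1 (hη v)).1)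
    (show delta (k := q + r) (ξ - η) = 0 by rw [delta_sub, hd, sub_self])
  refine ⟨(σ.map (r + 2)).compAlternatingMap θ, fun v => ⟨_, hθ v, rfl⟩, ?_⟩
  rw [delta_compAlternatingMap (L' := σ.map (r + 1)) fun u v => σ.contract_map (r + 1) u (hθ v),
    hdθ]
  ext1 v
  rw [← hσξ]
  simp [((hG (r + 1) _).1 (hη v)).2]

/-- `H^1` of the kernels is always zero: a tensor all of whose contractions are killed by `σ_r` is
killed by `σ_{r+1}`. -/
theorem deltaExact_kernel_zero (hG : σ.IsKernel G) (r : ℕ) : DeltaExact G 0 (q + r) := by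
  refine (deltaExact_zero_iff fun T hT => ((hG r T).1 hT).1).2 fun T hT => ?_
  obtain ⟨hTs, hTc⟩ := mem_prolongSymbolOne.1 hT
  refine (hG (r + 1) T).2 ⟨hTs, eq_zero_of_contract_eq_zero fun v => ?_⟩
  rw [σ.contract_map r v hTs, ((hG r _).1 (hTc v)).2]

/-- If the `σ_r` with `r ≥ 1` are onto, all cohomology of the kernels vanishes. -/
theorem deltaExact_kernel_of_surjective (hG : σ.IsKernel G)
    (h : ∀ r, σ.image (r + 1) = symTensor V F₀ (r + 1)) (i r : ℕ) : DeltaExact G i (q + r) := by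
  cases i with
  | zero => exact deltaExact_kernel_zero hG r
  | succ i =>
    exact deltaExact_kernel hG ((deltaExact_symTensor i (r + 1)).of_eq (h r).symm
      (h (r + 1)).symm)

theorem prolongSymbolOne_kernel (hG : σ.IsKernel G) (r : ℕ) :
    prolongSymbolOne (G (q + r)) = G (q + r + 1) := by
  refine le_antisymm ((deltaExact_zero_iff fun T hT => ((hG r T).1 hT).1).1
    (deltaExact_kernel_zero hG r)) fun T hT => ?_
  obtain ⟨h1, h2⟩ := (hG (r + 1) T).1 hT
  refine mem_prolongSymbolOne.2 ⟨h1, fun v => (hG r _).2 ⟨contract_mem_symTensor h1 v, ?_⟩⟩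
  rw [← σ.contract_map r v h1, h2, map_zero]

end SymbolFamily

/-- A graded family each of whose terms is the prolongation of the preceding one consists of the
prolongations of its first term. -/
theorem prolongSymbol_eq {G : ∀ m, Submodule ℝ (V [×m]→L[ℝ] F)} {k : ℕ}
    (h : ∀ m, k ≤ m → prolongSymbolOne (G m) = G (m + 1)) (r : ℕ) :
    prolongSymbol (G k) r = G (k + r) := by
  induction r with
  | zero => rfl
  | succ r ih =>
    change prolongSymbolOne (prolongSymbol (G k) r) = _
    rw [ih, h _ (Nat.le_add_right k r)]
    rfl

theorem isAcyclic_iff {G : ∀ m, Submodule ℝ (V [×m]→L[ℝ] F)} {k : ℕ}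
    (h : ∀ m, k ≤ m → prolongSymbolOne (G m) = G (m + 1)) (p : ℕ) :
    IsAcyclic p (G k) ↔ ∀ i r, i + 1 ≤ p → DeltaExact G i (k + r) := by
  refine forall_congr' fun i => forall_congr' fun r => forall_congr' fun _ => ?_
  simp only [DeltaExact, prolongSymbol_eq h]
  exact Iff.rfl

end KernelImage

/-! ### Order of vanishing and symmetry of derivatives -/

section Calculus

variable {V F G H : Type*} [NormedAddCommGroup V] [NormedSpace ℝ V]
  [NormedAddCommGroup F] [NormedSpace ℝ F] [NormedAddCommGroup G] [NormedSpace ℝ G]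
  [NormedAddCommGroup H] [NormedSpace ℝ H]

/-- All derivatives of `h` of order `< m` vanish at `p`. -/
def VanishTo (m : ℕ) (h : V → F) (p : V) : Prop := ∀ i < m, iteratedFDeriv ℝ i h p = 0

namespace VanishTo

variable {m : ℕ} {f g h : V → F} {p : V}

theorem congr (hf : VanishTo m f p) (e : g =ᶠ[𝓝 p] f) : VanishTo m g p := fun i hi => by
  rw [(e.iteratedFDeriv ℝ i).eq_of_nhds, hf i hi]

theorem mono (hf : VanishTo m f p) {m' : ℕ} (e : m' ≤ m) : VanishTo m' f p :=
  fun i hi => hf i (hi.trans_le e)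

theorem sum {ι : Type*} {s : Finset ι} {f : ι → V → F} (hc : ∀ i ∈ s, ContDiffAt ℝ ∞ (f i) p)
    (h : ∀ i ∈ s, VanishTo m (f i) p) : VanishTo m (fun v => ∑ i ∈ s, f i v) p := by
  intro j hj
  rw [iteratedFDeriv_fun_sum_apply fun i hi => (hc i hi).of_le (by exact_mod_cast le_top)]
  exact Finset.sum_eq_zero fun i hi => h i hi j hj

/-- A continuous bilinear expression vanishes to the same order as its second factor. -/
theorem bilinear (B : G →L[ℝ] F →L[ℝ] H) {a : V → G} (hf : VanishTo m f p)
    (ha : ContDiffAt ℝ ∞ a p) (hc : ContDiffAt ℝ ∞ f p) :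
    VanishTo m (fun v => B (a v) (f v)) p := by
  intro n hn
  obtain ⟨u, hu, hau⟩ := (ha.of_le (m := (n : ℕ∞ω)) (by exact_mod_cast le_top)).contDiffOn' le_rfl
    (by simp)
  obtain ⟨u', hu', hfu⟩ := (hc.of_le (m := (n : ℕ∞ω)) (by exact_mod_cast le_top)).contDiffOn' le_rfl
    (by simp)
  simp only [Set.insert_eq_of_mem (Set.mem_univ _), Set.univ_inter] at hau hfu
  have ho : IsOpen (u ∩ u') := hu.inter hu'
  have hp : p ∈ u ∩ u' := ⟨hau.1, hfu.1⟩
  have := B.norm_iteratedFDerivWithin_le_of_bilinear (hau.2.mono Set.inter_subset_left)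
    (hfu.2.mono Set.inter_subset_right) ho.uniqueDiffOn hp (n := n) le_rfl
  simp only [iteratedFDerivWithin_of_isOpen _ ho hp] at this
  rw [Finset.sum_eq_zero, mul_zero] at this
  · exact norm_le_zero_iff.1 this
  · intro i _
    rw [hf (n - i) (by omega), norm_zero, mul_zero]

theorem clm_apply {A : V → F →L[ℝ] G} (hf : VanishTo m f p) (hA : ContDiffAt ℝ ∞ A p)
    (hc : ContDiffAt ℝ ∞ f p) : VanishTo m (fun v => A v (f v)) p :=
  hf.bilinear (ContinuousLinearMap.id ℝ (F →L[ℝ] G)) hA hc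

theorem comp {W : Type*} [NormedAddCommGroup W] [NormedSpace ℝ W] {τ : W → V} {w : W}
    (hf : VanishTo m f (τ w)) (hτ : ContDiffAt ℝ ∞ τ w) (hc : ContDiffAt ℝ ∞ f (τ w)) :
    VanishTo m (f ∘ τ) w := by
  intro n hn
  obtain ⟨u, hu, hτu⟩ := (hτ.of_le (m := (n : ℕ∞ω)) (by exact_mod_cast le_top)).contDiffOn' le_rfl
    (by simp)
  obtain ⟨u', hu', hfu⟩ := (hc.of_le (m := (n : ℕ∞ω)) (by exact_mod_cast le_top)).contDiffOn' le_rfl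
    (by simp)
  simp only [Set.insert_eq_of_mem (Set.mem_univ _), Set.univ_inter] at hτu hfu
  have ho : IsOpen (u ∩ τ ⁻¹' u') := hτu.2.continuousOn.isOpen_inter_preimage hu hu'
  have hw : w ∈ u ∩ τ ⁻¹' u' := ⟨hτu.1, hfu.1⟩
  set D : ℝ := 1 + ∑ i ∈ Finset.range (n + 1), ‖iteratedFDeriv ℝ i τ w‖
  have hs : 0 ≤ ∑ i ∈ Finset.range (n + 1), ‖iteratedFDeriv ℝ i τ w‖ :=
    Finset.sum_nonneg fun _ _ => norm_nonneg _
  have := norm_iteratedFDerivWithin_comp_le hfu.2 (hτu.2.mono Set.inter_subset_left) (n := n) le_rfl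
    hu'.uniqueDiffOn ho.uniqueDiffOn (fun v hv => hv.2) hw (C := 0) (D := D)
    (fun i hi => by rw [iteratedFDerivWithin_of_isOpen _ hu' hfu.1, hf i (by omega), norm_zero])
    (fun i h1 hi => by
      rw [iteratedFDerivWithin_of_isOpen _ ho hw]
      calc ‖iteratedFDeriv ℝ i τ w‖ ≤ ∑ i ∈ Finset.range (n + 1), ‖iteratedFDeriv ℝ i τ w‖ :=
            Finset.single_le_sum (f := fun i => ‖iteratedFDeriv ℝ i τ w‖)
              (fun _ _ => norm_nonneg _) (Finset.mem_range.2 (by omega))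
        _ ≤ D := by simp [D]
        _ ≤ D ^ i := le_self_pow₀ (by simpa [D] using hs) (by omega))
  rw [iteratedFDerivWithin_of_isOpen _ ho hw, mul_zero, zero_mul] at this
  exact norm_le_zero_iff.1 this

theorem linearIsometryEquiv_comp (hf : VanishTo m f p) (L : F ≃ₗᵢ[ℝ] G) :
    VanishTo m (L ∘ f) p := fun i hi => by
  rw [← norm_eq_zero, LinearIsometryEquiv.norm_iteratedFDeriv_comp_left, hf i hi, norm_zero]

theorem fderiv (hf : VanishTo (m + 1) f p) : VanishTo m (_root_.fderiv ℝ f) p := fun i hi => by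
  rw [← norm_eq_zero, norm_iteratedFDeriv_fderiv, hf (i + 1) (by omega), norm_zero]

theorem iteratedFDeriv {r j : ℕ} (hf : VanishTo (j + r) f p) :
    VanishTo r (_root_.iteratedFDeriv ℝ j f) p := by
  induction j generalizing r with
  | zero =>
    rw [iteratedFDeriv_zero_eq_comp]
    exact (hf.mono (by omega)).linearIsometryEquiv_comp
      (continuousMultilinearCurryFin0 ℝ V F).symm
  | succ j ih =>
    rw [iteratedFDeriv_succ_eq_comp_left]
    exact (ih (r := r + 1) (hf.mono (by omega))).fderiv.linearIsometryEquiv_comp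
      (continuousMultilinearCurryLeftEquiv ℝ (fun _ : Fin (j + 1) => V) F).symm

end VanishTo

theorem contract_iteratedFDeriv (h : V → F) (p : V) (j : ℕ) (a : V) :
    contract a (iteratedFDeriv ℝ (j + 1) h p) = fderiv ℝ (iteratedFDeriv ℝ j h) p a := by
  ext m
  rw [contract_apply, iteratedFDeriv_succ_apply_left]
  simp

/-- Contraction as a continuous linear map in the tensor. -/
noncomputable def contractL (k : ℕ) (b : V) : (V [×(k + 1)]→L[ℝ] F) →L[ℝ] (V [×k]→L[ℝ] F) :=
  (ContinuousLinearMap.apply ℝ (V [×k]→L[ℝ] F) b) ∘L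
    (continuousMultilinearCurryLeftEquiv ℝ (fun _ : Fin (k + 1) => V) F).toContinuousLinearEquiv

theorem contractL_apply (k : ℕ) (b : V) (T : V [×(k + 1)]→L[ℝ] F) :
    contractL k b T = contract b T := rfl

theorem _root_.ContDiffAt.iteratedFDeriv_infty {h : V → F} {p : V} (hh : ContDiffAt ℝ ∞ h p)
    (j : ℕ) : ContDiffAt ℝ ∞ (iteratedFDeriv ℝ j h) p := by
  exact hh.iteratedFDeriv_right (m := ∞) (i := j) (by exact_mod_cast le_top)

theorem _root_.ContDiffAt.fderiv_infty {h : V → F} {p : V} (hh : ContDiffAt ℝ ∞ h p) :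
    ContDiffAt ℝ ∞ (fderiv ℝ h) p :=
  hh.fderiv_right (m := ∞) (by exact_mod_cast le_top)

theorem _root_.ContDiffAt.fderiv_apply_infty {h : V → F} {p : V} (hh : ContDiffAt ℝ ∞ h p) (a : V) :
    ContDiffAt ℝ ∞ (fun v => fderiv ℝ h v a) p :=
  hh.fderiv_infty.clm_apply contDiffAt_const

theorem contract_contract_iteratedFDeriv {h : V → F} {p : V} (hh : ContDiffAt ℝ ∞ h p) (j : ℕ)
    (a b : V) : contract b (contract a (iteratedFDeriv ℝ (j + 2) h p)) =
      fderiv ℝ (fderiv ℝ (iteratedFDeriv ℝ j h)) p a b := by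
  have h1 : DifferentiableAt ℝ (iteratedFDeriv ℝ (j + 1) h) p :=
    (hh.iteratedFDeriv_infty (j + 1)).differentiableAt (by simp)
  have h2 : DifferentiableAt ℝ (fderiv ℝ (iteratedFDeriv ℝ j h)) p :=
    (hh.iteratedFDeriv_infty j).fderiv_infty.differentiableAt (by simp)
  have e : (fun v => contractL j b (iteratedFDeriv ℝ (j + 1) h v)) =
      fun v => fderiv ℝ (iteratedFDeriv ℝ j h) v b := by
    ext1 v
    rw [contractL_apply, contract_iteratedFDeriv]
  have e1 := ((contractL j b).hasFDerivAt.comp p h1.hasFDerivAt).fderiv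
  have e2 := (h2.hasFDerivAt.clm_apply (hasFDerivAt_const b p)).fderiv
  have e3 := e1.symm.trans ((congrArg (fun f => fderiv ℝ f p) e).trans e2)
  have e4 := congrArg (fun f => f a) e3
  simpa [contractL_apply, contract_iteratedFDeriv] using e4

theorem contract_contract_iteratedFDeriv_comm {h : V → F} {p : V} (hh : ContDiffAt ℝ ∞ h p) (j : ℕ)
    (a b : V) : contract b (contract a (iteratedFDeriv ℝ (j + 2) h p)) =
      contract a (contract b (iteratedFDeriv ℝ (j + 2) h p)) := by
  rw [contract_contract_iteratedFDeriv hh, contract_contract_iteratedFDeriv hh]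
  exact ((hh.iteratedFDeriv_infty j).isSymmSndFDerivAt (by
    simp only [minSmoothness_of_isRCLikeNormedField]
    exact WithTop.coe_le_coe.2 (le_top : (2 : ℕ∞) ≤ ⊤))).eq _ _

/-- The derivatives of a directional derivative are the contractions of the derivatives; this uses
the symmetry of second derivatives, since `iteratedFDeriv` adds its new argument in front. -/
theorem iteratedFDeriv_fderiv_apply {h : V → F} (a : V) : ∀ (j : ℕ) {p : V},
    (∀ᶠ v in 𝓝 p, ContDiffAt ℝ ∞ h v) →
      iteratedFDeriv ℝ j (fun v => fderiv ℝ h v a) p = contract a (iteratedFDeriv ℝ (j + 1) h p)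
  | 0, p, _ => by
    ext m
    rw [contract_apply, iteratedFDeriv_zero_apply, iteratedFDeriv_one_apply]
    rfl
  | j + 1, p, hh => by
    have e : iteratedFDeriv ℝ j (fun v => fderiv ℝ h v a) =ᶠ[𝓝 p]
        fun v => contractL j a (iteratedFDeriv ℝ (j + 1) h v) :=
      hh.eventually_nhds.mono fun v hv => iteratedFDeriv_fderiv_apply a j hv
    have h1 : DifferentiableAt ℝ (iteratedFDeriv ℝ (j + 1) h) p :=
      (hh.self_of_nhds.iteratedFDeriv_infty (j + 1)).differentiableAt (by simp)
    refine eq_of_contract_eq fun b => ?_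
    have e1 := ((contractL j a).hasFDerivAt.comp p h1.hasFDerivAt).fderiv
    rw [contract_iteratedFDeriv, e.fderiv_eq]
    refine (congrArg (fun l => l b) e1).trans ?_
    rw [contract_contract_iteratedFDeriv_comm hh.self_of_nhds j a b,
      contract_iteratedFDeriv, ContinuousLinearMap.comp_apply, contractL_apply]

theorem iteratedFDeriv_mem_symTensor : ∀ (j : ℕ) {h : V → F} {p : V},
    (∀ᶠ v in 𝓝 p, ContDiffAt ℝ ∞ h v) → iteratedFDeriv ℝ j h p ∈ symTensor V F j
  | 0, _, _, _ => by simp [symTensor_eq_top_of_le_one]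
  | 1, _, _, _ => by simp [symTensor_eq_top_of_le_one]
  | j + 2, h, p, hh => by
    refine mem_symTensor_of_contract (fun v => ?_)
      fun a b => contract_contract_iteratedFDeriv_comm hh.self_of_nhds j b a
    rw [← iteratedFDeriv_fderiv_apply v (j + 1) hh]
    exact iteratedFDeriv_mem_symTensor (j + 1) (hh.mono fun w hw => hw.fderiv_apply_infty v)

/-- There is a polynomial map with prescribed symmetric derivatives of order `≤ k` at a point. -/
theorem exists_contDiff_iteratedFDeriv_eq [CompleteSpace F] (k : ℕ) (T : ∀ j, V [×j]→L[ℝ] F)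
    (hT : ∀ j ≤ k, T j ∈ symTensor V F j) (p : V) :
    ∃ h : V → F, ContDiff ℝ ∞ h ∧ ∀ j ≤ k, iteratedFDeriv ℝ j h p = T j := by
  let P : FormalMultilinearSeries ℝ V F := fun j =>
    if j ≤ k then ((j.factorial : ℝ)⁻¹) • T j else 0
  let h : V → F := fun v => ∑ j ∈ Finset.range (k + 1), P j fun _ => v - p
  have hP : HasFPowerSeriesOnBall h P p ⊤ := by
    refine ⟨?_, by simp, fun {y} _ => ?_⟩
    · rw [P.radius_eq_top_of_forall_image_add_eq_zero (k + 1) fun j => by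
        simp only [P]
        rw [if_neg (by omega)]]
    · have : h (p + y) = ∑ j ∈ Finset.range (k + 1), P j fun _ => y := by simp [h]
      rw [this]
      refine hasSum_sum_of_ne_finset_zero fun j hj => ?_
      simp only [P]
      rw [if_neg (by simpa using hj)]
      rfl
  have hc : ContDiff ℝ ∞ h := by
    refine ContDiff.sum fun j _ => ?_
    exact (P j).contDiff.comp (contDiff_pi.2 fun _ => contDiff_id.sub contDiff_const)
  refine ⟨h, hc, fun j hj => ?_⟩
  ext v
  -- The derivative is the sum over all permutations of the coefficient, whence the factor `1 / j!`.
  rw [hP.iteratedFDeriv_eq_sum_of_completeSpace]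
  have : ∀ σ : Equiv.Perm (Fin j), P j (fun i => v (σ i)) = (j.factorial : ℝ)⁻¹ • T j v := by
    intro σ
    simp only [P, if_pos hj]
    exact congrArg (fun c => (j.factorial : ℝ)⁻¹ • c) (hT j hj σ v)
  rw [Finset.sum_congr rfl fun σ _ => this σ]
  have h0 : (j.factorial : ℝ) ≠ 0 := by positivity
  simp [Fintype.card_perm, ← Nat.cast_smul_eq_nsmul ℝ, smul_smul, h0]

theorem contDiffAt_matrix_det {n : Type*} [Fintype n] [DecidableEq n] {M : V → Matrix n n ℝ} {p : V}
    (h : ∀ i j, ContDiffAt ℝ ∞ (fun v => M v i j) p) : ContDiffAt ℝ ∞ (fun v => (M v).det) p := by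
  simp only [Matrix.det_apply]
  exact ContDiffAt.sum fun σ _ => ContDiffAt.const_smul _ (contDiffAt_prod fun i _ => h _ _)

theorem contDiffAt_matrix_inv {n : Type*} [Fintype n] [DecidableEq n] {M : V → Matrix n n ℝ} {p : V}
    (h : ∀ i j, ContDiffAt ℝ ∞ (fun v => M v i j) p) (h0 : (M p).det ≠ 0) (i j : n) :
    ContDiffAt ℝ ∞ (fun v => (M v)⁻¹ i j) p := by
  simp only [Matrix.inv_def, Ring.inverse_eq_inv', Matrix.smul_apply, Matrix.adjugate_apply,
    smul_eq_mul]
  refine ((contDiffAt_matrix_det h).inv h0).mul (contDiffAt_matrix_det fun k l => ?_)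
  by_cases hk : k = j
  · subst hk
    simp only [Matrix.updateRow_self]
    exact contDiffAt_const
  · simp only [Matrix.updateRow_ne hk]
    exact h k l

end Calculus

/-! ### Local representatives of sections -/

section LocalRepresentatives

set_option linter.unusedSectionVars false

variable {V : Type*} [NormedAddCommGroup V] [NormedSpace ℝ V]
  {X : Type*} [TopologicalSpace X] [ChartedSpace V X]
  {F : Type*} [NormedAddCommGroup F] [NormedSpace ℝ F]
  {E : X → Type*} [TopologicalSpace (TotalSpace F E)] [∀ x, TopologicalSpace (E x)]
  [∀ x, AddCommGroup (E x)] [∀ x, Module ℝ (E x)] [FiberBundle F E] [VectorBundle ℝ F E]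

variable (V F E) in
/-- The points at which both the chart and the trivialization around `x` are defined. -/
def coordDomain (x : X) : Set X := (chartAt V x).source ∩ (trivializationAt F E x).baseSet

theorem mem_coordDomain_self (x : X) : x ∈ coordDomain V F E x :=
  ⟨mem_chart_source V x, mem_baseSet_trivializationAt F E x⟩

theorem isOpen_coordDomain (x : X) : IsOpen (coordDomain V F E x) :=
  (chartAt V x).open_source.inter (trivializationAt F E x).open_baseSet

theorem eventually_chart_symm {x y : X} (hy : y ∈ (chartAt V x).source) {p : X → Prop}
    (hp : ∀ᶠ z in 𝓝 y, p z) :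
    ∀ᶠ v in 𝓝 (chartAt V x y), v ∈ (chartAt V x).target ∧ p ((chartAt V x).symm v) := by
  have hv := (chartAt V x).map_source hy
  have h := (chartAt V x).continuousAt_symm hv
  rw [ContinuousAt, (chartAt V x).left_inv hy] at h
  exact ((chartAt V x).open_target.eventually_mem hv).and (h.eventually hp)

theorem eventually_chart {x y : X} (hy : y ∈ (chartAt V x).source) {p : V → Prop}
    (hp : ∀ᶠ v in 𝓝 (chartAt V x y), p v) : ∀ᶠ z in 𝓝 y, p (chartAt V x z) :=
  ((chartAt V x).continuousAt hy).eventually hp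

theorem localRep_chart {x y : X} (hy : y ∈ (chartAt V x).source) (f : SmoothSection V F E) :
    localRep x f (chartAt V x y) = (trivializationAt F E x ⟨y, f y⟩).2 := by
  unfold localRep
  rw [(chartAt V x).left_inv hy]

theorem localRep_chart_eq_zero {x y : X} (hy : y ∈ coordDomain V F E x)
    {f : SmoothSection V F E} : localRep x f (chartAt V x y) = 0 ↔ f y = 0 := by
  rw [localRep_chart hy.1]
  exact ((trivializationAt F E x).continuousLinearEquivAt ℝ y hy.2).map_eq_zero_iff

theorem localRep_add_apply {x y : X} (hy : y ∈ coordDomain V F E x)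
    (f g : SmoothSection V F E) : localRep x (f + g) (chartAt V x y) =
      localRep x f (chartAt V x y) + localRep x g (chartAt V x y) := by
  simp only [localRep_chart hy.1]
  exact ((trivializationAt F E x).linear ℝ hy.2).map_add _ _

theorem localRep_smul_apply {x y : X} (hy : y ∈ coordDomain V F E x) (c : ℝ)
    (f : SmoothSection V F E) :
    localRep x (c • f) (chartAt V x y) = c • localRep x f (chartAt V x y) := by
  simp only [localRep_chart hy.1]
  exact ((trivializationAt F E x).linear ℝ hy.2).map_smul _ _

theorem localRep_add_eventuallyEq {x y : X} (hy : y ∈ coordDomain V F E x)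
    (f g : SmoothSection V F E) :
    localRep x (f + g) =ᶠ[𝓝 (chartAt V x y)] localRep x f + localRep x g := by
  filter_upwards [eventually_chart_symm hy.1 ((isOpen_coordDomain x).mem_nhds hy)] with v hv
  have := localRep_add_apply hv.2 f g
  rwa [(chartAt V x).right_inv hv.1] at this

theorem localRep_smul_eventuallyEq {x y : X} (hy : y ∈ coordDomain V F E x) (c : ℝ)
    (f : SmoothSection V F E) :
    localRep x (c • f) =ᶠ[𝓝 (chartAt V x y)] c • localRep x f := by
  filter_upwards [eventually_chart_symm hy.1 ((isOpen_coordDomain x).mem_nhds hy)] with v hv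
  have := localRep_smul_apply hv.2 c f
  rwa [(chartAt V x).right_inv hv.1] at this

/-- The section of the trivial line bundle given by a smooth function. -/
def scalarSection (g : X → ℝ) (hg : ContMDiff 𝓘(ℝ, V) 𝓘(ℝ, ℝ) ∞ g) :
    SmoothSection V ℝ (Bundle.Trivial X ℝ) :=
  ⟨g, fun y => (contMDiffAt_section y).2 (hg y)⟩

theorem contMDiff_scalar (a : SmoothSection V ℝ (Bundle.Trivial X ℝ)) :
    ContMDiff 𝓘(ℝ, V) 𝓘(ℝ, ℝ) ∞ fun y => (a y : ℝ) :=
  fun y => (contMDiffAt_section y).1 (a.contMDiff y)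

theorem localRep_scalar (x : X) (a : SmoothSection V ℝ (Bundle.Trivial X ℝ)) (v : V) :
    localRep x a v = a ((chartAt V x).symm v) := rfl

theorem localRep_scalar_chart {x y : X} (hy : y ∈ (chartAt V x).source)
    (a : SmoothSection V ℝ (Bundle.Trivial X ℝ)) : localRep x a (chartAt V x y) = a y :=
  localRep_chart hy a

variable [IsManifold 𝓘(ℝ, V) ∞ X]

theorem contDiffAt_comp_chart_symm {W : Type*} [NormedAddCommGroup W] [NormedSpace ℝ W] {x y : X}
    (hy : y ∈ (chartAt V x).source) {g : X → W} (hg : ContMDiffAt 𝓘(ℝ, V) 𝓘(ℝ, W) ∞ g y) :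
    ContDiffAt ℝ ∞ (fun v => g ((chartAt V x).symm v)) (chartAt V x y) := by
  rw [← contMDiffAt_iff_contDiffAt]
  exact hg.comp_of_eq (f := (chartAt V x).symm) (I := 𝓘(ℝ, V)) (x := chartAt V x y)
    ((contMDiffOn_chart_symm (I := 𝓘(ℝ, V)) (n := ∞) (x := x)).contMDiffAt
      ((chartAt V x).open_target.mem_nhds ((chartAt V x).map_source hy)))
    ((chartAt V x).left_inv hy)

theorem contMDiffAt_comp_chart {W : Type*} [NormedAddCommGroup W] [NormedSpace ℝ W] {x y : X}
    (hy : y ∈ (chartAt V x).source) {h : V → W} (hh : ContDiffAt ℝ ∞ h (chartAt V x y)) :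
    ContMDiffAt 𝓘(ℝ, V) 𝓘(ℝ, W) ∞ (fun z => h (chartAt V x z)) y :=
  hh.contMDiffAt.comp y ((contMDiffOn_chart (I := 𝓘(ℝ, V)) (n := ∞) (x := x)).contMDiffAt
    ((chartAt V x).open_source.mem_nhds hy))

variable [ContMDiffVectorBundle ∞ F E 𝓘(ℝ, V)]

theorem contDiffAt_localRep_chart {x y : X} (hy : y ∈ coordDomain V F E x)
    (f : SmoothSection V F E) : ContDiffAt ℝ ∞ (localRep x f) (chartAt V x y) :=
  contDiffAt_comp_chart_symm (g := fun z => (trivializationAt F E x ⟨z, f z⟩).2) hy.1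
    (((trivializationAt F E x).contMDiffAt_section_iff hy.2).1 (f.contMDiff y))

theorem eventually_contDiffAt_localRep {x y : X} (hy : y ∈ coordDomain V F E x)
    (f : SmoothSection V F E) :
    ∀ᶠ v in 𝓝 (chartAt V x y), ContDiffAt ℝ ∞ (localRep x f) v := by
  filter_upwards [eventually_chart_symm hy.1 ((isOpen_coordDomain x).mem_nhds hy)] with v hv
  have := contDiffAt_localRep_chart hv.2 f
  rwa [(chartAt V x).right_inv hv.1] at this

/-- The order of vanishing of a section does not depend on the chart and the trivialization. -/
theorem VanishTo.localRep_change {x y z : X} (hx : z ∈ coordDomain V F E x)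
    (hy : z ∈ coordDomain V F E y) {f : SmoothSection V F E} {m : ℕ}
    (h : VanishTo m (localRep x f) (chartAt V x z)) :
    VanishTo m (localRep y f) (chartAt V y z) := by
  set φ := chartAt V x
  set ψ := chartAt V y
  set e := trivializationAt F E x
  set e' := trivializationAt F E y
  let τ : V → V := fun v => φ (ψ.symm v)
  let c : V → F →L[ℝ] F := fun v => (e.coordChangeL ℝ e' (ψ.symm v) : F →L[ℝ] F)
  have hz : ψ.symm (ψ z) = z := ψ.left_inv hy.1
  have hτz : τ (ψ z) = φ z := by simp only [τ, hz]
  have hτ : ContDiffAt ℝ ∞ τ (ψ z) := contDiffAt_comp_chart_symm (W := V) (g := φ) hy.1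
    ((contMDiffOn_chart (I := 𝓘(ℝ, V)) (n := ∞) (x := x)).contMDiffAt
      (φ.open_source.mem_nhds hx.1))
  have hc : ContDiffAt ℝ ∞ c (ψ z) := contDiffAt_comp_chart_symm
    (g := fun b => (e.coordChangeL ℝ e' b : F →L[ℝ] F)) hy.1 (contMDiffAt_coordChangeL hx.2 hy.2)
  have hf : ContDiffAt ℝ ∞ (localRep x f) (τ (ψ z)) := by
    rw [hτz]
    exact contDiffAt_localRep_chart hx f
  have h1 : VanishTo m (localRep x f ∘ τ) (ψ z) := VanishTo.comp (by rwa [hτz]) hτ hf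
  refine (h1.bilinear (ContinuousLinearMap.id ℝ (F →L[ℝ] F)) hc (hf.comp _ hτ)).congr ?_
  filter_upwards [eventually_chart_symm hy.1 (((isOpen_coordDomain (V := V) (F := F) (E := E)
    x).inter (isOpen_coordDomain y)).mem_nhds ⟨hx, hy⟩)] with v hv
  obtain ⟨_, hv1, hv2⟩ := hv
  have : (f (ψ.symm v)) = e.symm (ψ.symm v) (localRep x f (τ v)) := by
    simp only [τ]
    rw [localRep_chart hv1.1, e.symm_apply_apply_mk hv1.2]
  change (e' ⟨ψ.symm v, f (ψ.symm v)⟩).2 = c v (localRep x f (τ v))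
  rw [this]
  exact (e.coordChangeL_apply e' ⟨hv1.2, hv2.2⟩ _).symm

theorem mem_flat_iff {m : ℕ} {x : X} {f : SmoothSection V F E} :
    f ∈ (flat m x : Submodule ℝ (SmoothSection V F E)) ↔
      VanishTo m (localRep x f) (chartAt V x x) := by
  simp only [flat, Submodule.mem_iInf, LinearMap.mem_ker]
  exact ⟨fun h i hi => h ⟨i, hi⟩, fun h i => h i i.2⟩

/-- Vanishing to some order may be tested in the chart and trivialization around any nearby
point. -/
theorem mem_flat_iff_of_mem {m : ℕ} {x y : X} (hy : y ∈ coordDomain V F E x)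
    {f : SmoothSection V F E} : f ∈ (flat m y : Submodule ℝ (SmoothSection V F E)) ↔
      VanishTo m (localRep x f) (chartAt V x y) :=
  mem_flat_iff.trans ⟨fun h => h.localRep_change (mem_coordDomain_self y) hy,
    fun h => h.localRep_change hy (mem_coordDomain_self y)⟩

variable [FiniteDimensional ℝ V] [T2Space X]

variable (V) in
theorem exists_bump {x : X} {U : Set X} (hU : U ∈ 𝓝 x) :
    ∃ χ : X → ℝ, ContMDiff 𝓘(ℝ, V) 𝓘(ℝ, ℝ) ∞ χ ∧ tsupport χ ⊆ U ∧ ∀ᶠ y in 𝓝 x, χ y = 1 := by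
  obtain ⟨χ, -, h⟩ := (SmoothBumpFunction.nhds_basis_tsupport (I := 𝓘(ℝ, V)) x).mem_iff.1 hU
  exact ⟨χ, χ.contMDiff, h, χ.eventuallyEq_one⟩

variable (F E) in
/-- Germs of smooth maps are local representatives of global sections, on a neighbourhood that
depends only on the domain of smoothness. -/
theorem exists_localRep_eqOn {x : X} {O : Set V} (hO : O ∈ 𝓝 (chartAt V x x)) :
    ∃ N ∈ 𝓝 (chartAt V x x), ∀ h : V → F, (∀ v ∈ O, ContDiffAt ℝ ∞ h v) →
      ∃ f : SmoothSection V F E, Set.EqOn (localRep x f) h N := by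
  set e := trivializationAt F E x
  let U : Set X := coordDomain V F E x ∩ (chartAt V x ⁻¹' interior O ∩ (chartAt V x).source)
  have hUo : IsOpen U := (isOpen_coordDomain x).inter (by
    rw [Set.inter_comm]
    exact (chartAt V x).isOpen_inter_preimage isOpen_interior)
  have hxU : x ∈ U := ⟨mem_coordDomain_self x, mem_interior_iff_mem_nhds.2 hO, mem_chart_source V x⟩
  obtain ⟨χ, hχ, hsupp, h1⟩ := exists_bump V (hUo.mem_nhds hxU)
  refine ⟨_, eventually_chart_symm (mem_chart_source V x) (h1.and (hUo.mem_nhds hxU)),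
    fun h hh => ?_⟩
  have hs : ContMDiffOn 𝓘(ℝ, V) (𝓘(ℝ, V).prod 𝓘(ℝ, F)) ∞
      (fun y => (⟨y, e.symm y (h (chartAt V x y))⟩ : TotalSpace F E)) U := by
    rw [e.contMDiffOn_section_iff hUo fun y hy => hy.1.2]
    refine ContMDiffOn.congr (f := fun y => h (chartAt V x y)) (fun y hy => ?_) fun y hy => ?_
    · exact (contMDiffAt_comp_chart hy.1.1 (hh _ (interior_subset hy.2.1))).contMDiffWithinAt
    · rw [e.apply_mk_symm hy.1.2]
  refine ⟨⟨_, ContMDiffOn.smul_section_of_tsupport hχ.contMDiffOn hUo hsupp hs⟩, ?_⟩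
  rintro v ⟨hv, hv1, hvU⟩
  have h2 : localRep x (⟨_, ContMDiffOn.smul_section_of_tsupport hχ.contMDiffOn hUo hsupp hs⟩ :
      SmoothSection V F E) v = (e ⟨(chartAt V x).symm v, χ ((chartAt V x).symm v) •
        e.symm ((chartAt V x).symm v) (h (chartAt V x ((chartAt V x).symm v)))⟩).2 := rfl
  rw [h2, hv1, one_smul, e.apply_mk_symm hvU.1.2, (chartAt V x).right_inv hv]

variable (F E) in
theorem exists_localRep_eventuallyEq {x : X} {h : V → F}
    (hh : ∀ᶠ v in 𝓝 (chartAt V x x), ContDiffAt ℝ ∞ h v) :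
    ∃ f : SmoothSection V F E, localRep x f =ᶠ[𝓝 (chartAt V x x)] h := by
  obtain ⟨N, hN, H⟩ := exists_localRep_eqOn F E hh
  obtain ⟨f, hf⟩ := H h fun v hv => hv
  exact ⟨f, hf.eventuallyEq_of_mem hN⟩

/-- A smooth function germ at `x` is the germ of a global smooth function. -/
theorem exists_scalar_eventuallyEq {x : X} {h : V → ℝ}
    (hh : ∀ᶠ v in 𝓝 (chartAt V x x), ContDiffAt ℝ ∞ h v) :
    ∃ a : SmoothSection V ℝ (Bundle.Trivial X ℝ), ∀ᶠ y in 𝓝 x, (a y : ℝ) = h (chartAt V x y) := by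
  obtain ⟨a, ha⟩ := exists_localRep_eventuallyEq ℝ (Bundle.Trivial X ℝ) hh
  refine ⟨a, ?_⟩
  filter_upwards [eventually_chart (mem_chart_source V x) ha,
    (chartAt V x).open_source.mem_nhds (mem_chart_source V x)] with y hy hy'
  rw [← hy, localRep_scalar_chart hy']

/-- Every linear functional of the derivatives of order `≤ k` in the chart around `x` is, near `x`,
the value of a scalar differential operator. -/
theorem exists_scalarOp (k : ℕ) (x : X)
    (l : (∀ j : Fin (k + 1), V [×(j : ℕ)]→L[ℝ] F) →L[ℝ] ℝ) :
    ∃ Q : ScalarOp V F E, IsDiffOp k Q ∧ ∀ᶠ y in 𝓝 x, ∀ f : SmoothSection V F E,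
      (Q f y : ℝ) = l fun j => iteratedFDeriv ℝ j (localRep x f) (chartAt V x y) := by
  obtain ⟨χ, hχ, hsupp, h1⟩ :=
    exists_bump V ((isOpen_coordDomain (V := V) (F := F) (E := E) x).mem_nhds
      (mem_coordDomain_self x))
  have h0 : ∀ y ∉ coordDomain V F E x, χ y = 0 := fun y hy =>
    image_eq_zero_of_notMem_tsupport fun h => hy (hsupp h)
  let J : SmoothSection V F E → X → ∀ j : Fin (k + 1), V [×(j : ℕ)]→L[ℝ] F := fun f y j =>
    iteratedFDeriv ℝ j (localRep x f) (chartAt V x y)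
  have hJ : ∀ f, ContMDiff 𝓘(ℝ, V) 𝓘(ℝ, ℝ) ∞ fun y => χ y * l (J f y) := by
    intro f
    refine contMDiff_of_tsupport fun y hy => ?_
    have hy' : y ∈ coordDomain V F E x := hsupp (tsupport_mul_subset_left hy)
    refine (hχ y).mul ?_
    refine contMDiffAt_comp_chart (h := fun v => l fun j => iteratedFDeriv ℝ j (localRep x f) v)
      hy'.1 ?_
    exact l.contDiff.contDiffAt.comp _ (contDiffAt_pi.2 fun j =>
      (contDiffAt_localRep_chart hy' f).iteratedFDeriv_infty j)
  have hle : ∀ j : ℕ, (j : ℕ∞ω) ≤ ∞ := fun j => by exact_mod_cast le_top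
  refine ⟨{ toFun := fun f => scalarSection _ (hJ f), map_add' := fun f g => ?_,
            map_smul' := fun c f => ?_ }, fun y f hf => ?_, ?_⟩
  · ext y
    change χ y * l (J (f + g) y) = χ y * l (J f y) + χ y * l (J g y)
    by_cases hy : y ∈ coordDomain V F E x
    · have : J (f + g) y = J f y + J g y := by
        funext j
        simp only [J, Pi.add_apply]
        rw [((localRep_add_eventuallyEq hy f g).iteratedFDeriv ℝ j).eq_of_nhds,
          iteratedFDeriv_add_apply ((contDiffAt_localRep_chart hy f).of_le (hle j))
            ((contDiffAt_localRep_chart hy g).of_le (hle j))]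
      rw [this, map_add, mul_add]
    · simp [h0 y hy]
  · ext y
    change χ y * l (J (c • f) y) = c * (χ y * l (J f y))
    by_cases hy : y ∈ coordDomain V F E x
    · have : J (c • f) y = c • J f y := by
        funext j
        simp only [J, Pi.smul_apply]
        rw [((localRep_smul_eventuallyEq hy c f).iteratedFDeriv ℝ j).eq_of_nhds,
          iteratedFDeriv_const_smul_apply ((contDiffAt_localRep_chart hy f).of_le (hle j))]
      rw [this, map_smul, smul_eq_mul]
      ring
    · simp [h0 y hy]
  · change χ y * l (J f y) = 0
    by_cases hy : y ∈ coordDomain V F E x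
    · have hf' := (mem_flat_iff_of_mem hy).1 ((Submodule.Quotient.mk_eq_zero _).1 hf)
      have : J f y = 0 := by
        funext j
        exact hf' j j.2
      rw [this, map_zero, mul_zero]
    · simp [h0 y hy]
  · filter_upwards [h1] with y hy f
    change χ y * l (J f y) = _
    rw [hy, one_mul]

end LocalRepresentatives

/-! ### Differential operators in coordinates -/

section DifferentialOperators

set_option linter.unusedSectionVars false

instance finiteDimensional_tensor {V F : Type*} [NormedAddCommGroup V] [NormedSpace ℝ V]
    [NormedAddCommGroup F] [NormedSpace ℝ F] [FiniteDimensional ℝ V] [FiniteDimensional ℝ F]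
    (j : ℕ) : FiniteDimensional ℝ (V [×j]→L[ℝ] F) :=
  Module.Finite.of_injective (R := ℝ)
    ({ toFun := fun T => T.toMultilinearMap, map_add' := fun _ _ => rfl,
       map_smul' := fun _ _ => rfl } :
      (V [×j]→L[ℝ] F) →ₗ[ℝ] MultilinearMap ℝ (fun _ : Fin j => V) F)
    ContinuousMultilinearMap.toMultilinearMap_injective

variable {V : Type*} [NormedAddCommGroup V] [NormedSpace ℝ V]
  {X : Type*} [TopologicalSpace X] [ChartedSpace V X] [IsManifold 𝓘(ℝ, V) ∞ X]
  {F : Type*} [NormedAddCommGroup F] [NormedSpace ℝ F]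
  {E : X → Type*} [TopologicalSpace (TotalSpace F E)] [∀ x, TopologicalSpace (E x)]
  [∀ x, AddCommGroup (E x)] [∀ x, Module ℝ (E x)] [FiberBundle F E] [VectorBundle ℝ F E]
  [ContMDiffVectorBundle ∞ F E 𝓘(ℝ, V)]
  {F₀ : Type*} [NormedAddCommGroup F₀] [NormedSpace ℝ F₀]
  {E₀ : X → Type*} [TopologicalSpace (TotalSpace F₀ E₀)] [∀ x, TopologicalSpace (E₀ x)]
  [∀ x, AddCommGroup (E₀ x)] [∀ x, Module ℝ (E₀ x)] [FiberBundle F₀ E₀] [VectorBundle ℝ F₀ E₀]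
  [ContMDiffVectorBundle ∞ F₀ E₀ 𝓘(ℝ, V)]

theorem jet_eq_zero_iff {k : ℕ} {x : X} {f : SmoothSection V F E} :
    jet k x f = 0 ↔ f ∈ (flat (k + 1) x : Submodule ℝ (SmoothSection V F E)) :=
  Submodule.Quotient.mk_eq_zero _

theorem jet_eq_iff {k : ℕ} {x : X} {f g : SmoothSection V F E} :
    jet k x f = jet k x g ↔ f - g ∈ (flat (k + 1) x : Submodule ℝ (SmoothSection V F E)) := by
  rw [← jet_eq_zero_iff, map_sub, sub_eq_zero]

theorem mem_flat_one_iff {x : X} {f : SmoothSection V F E} :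
    f ∈ (flat 1 x : Submodule ℝ (SmoothSection V F E)) ↔ f x = 0 := by
  rw [mem_flat_iff, ← localRep_chart_eq_zero (mem_coordDomain_self x)]
  constructor
  · intro h
    have := h 0 one_pos
    rw [← norm_eq_zero, norm_iteratedFDeriv_zero] at this
    exact norm_eq_zero.1 this
  · intro h i hi
    obtain rfl : i = 0 := by omega
    rw [← norm_eq_zero, norm_iteratedFDeriv_zero, h, norm_zero]

/-- Evaluation of sections at a point. -/
noncomputable def evalAt (x : X) : SmoothSection V F E →ₗ[ℝ] E x where
  toFun f := f x
  map_add' _ _ := rfl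
  map_smul' _ _ := rfl

theorem evalAt_apply (x : X) (f : SmoothSection V F E) : evalAt x f = f x := rfl

/-- If finitely many scalar operators take all values at `x` and their common zeros are zeros of
`S`, then near `x` the operator `S` is a combination of them with smooth coefficients. -/
theorem exists_expansion {p : ℕ} {P : Fin p → ScalarOp V F E} {x : X}
    (hP : ∀ c : Fin p → ℝ, ∃ f, ∀ τ, P τ f x = c τ)
    (S : SmoothSection V F E →ₗ[ℝ] SmoothSection V F₀ E₀)
    (hS : ∀ᶠ y in 𝓝 x, ∀ f, (∀ τ, P τ f y = 0) → S f y = 0) :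
    ∃ s : Fin p → V → F₀, (∀ τ, ∀ᶠ v in 𝓝 (chartAt V x x), ContDiffAt ℝ ∞ (s τ) v) ∧
      ∀ᶠ v in 𝓝 (chartAt V x x), ∀ f,
        localRep x (S f) v = ∑ τ, localRep x (P τ f) v • s τ v := by
  choose f hf using fun j : Fin p => hP (Pi.single j 1)
  let G : V → Matrix (Fin p) (Fin p) ℝ := fun v τ j => localRep x (P τ (f j)) v
  have hG : ∀ᶠ v in 𝓝 (chartAt V x x), ∀ τ j, ContDiffAt ℝ ∞ (fun v => G v τ j) v := by
    simp only [eventually_all]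
    exact fun τ j => eventually_contDiffAt_localRep (mem_coordDomain_self x) _
  have hG1 : G (chartAt V x x) = 1 := by
    ext τ j
    simp only [G]
    rw [localRep_scalar_chart (mem_chart_source V x), hf, Matrix.one_apply, Pi.single_apply]
  have hdet : ∀ᶠ v in 𝓝 (chartAt V x x), (G v).det ≠ 0 :=
    (contDiffAt_matrix_det hG.self_of_nhds).continuousAt.eventually_ne (by simp [hG1])
  refine ⟨fun τ v => ∑ j, (G v)⁻¹ j τ • localRep x (S (f j)) v, fun τ => ?_, ?_⟩
  · have hc : ∀ᶠ v in 𝓝 (chartAt V x x), ∀ j, ContDiffAt ℝ ∞ (localRep x (S (f j))) v :=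
      eventually_all.2 fun j => eventually_contDiffAt_localRep (mem_coordDomain_self x) _
    filter_upwards [hG, hdet, hc] with v h1 h2 h3
    exact ContDiffAt.sum fun j _ => (contDiffAt_matrix_inv h1 h2 j τ).smul (h3 j)
  · filter_upwards [hdet, eventually_chart_symm (mem_chart_source V x) (hS.and
      ((isOpen_coordDomain (V := V) (F := F₀) (E := E₀) x).eventually_mem
        (mem_coordDomain_self x)))] with v hv h2 g
    obtain ⟨-, h3, h4⟩ := h2
    set y := (chartAt V x).symm v
    -- Subtracting from `g` a combination of the `f_j` yields a common zero of the `P_τ` at `y`.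
    let c : Fin p → ℝ := (G v)⁻¹.mulVec fun τ => P τ g y
    have hc : (G v).mulVec c = fun τ => (P τ g y : ℝ) := by
      simp only [c, Matrix.mulVec_mulVec, Matrix.mul_nonsing_inv _ (isUnit_iff_ne_zero.2 hv),
        Matrix.one_mulVec]
    have h5 : ∀ τ, P τ (g - ∑ j, c j • f j) y = 0 := by
      intro τ
      have e1 : P τ (g - ∑ j, c j • f j) y =
          evalAt y (P τ g) - ∑ j, c j • evalAt y (P τ (f j)) := by
        rw [← evalAt_apply]
        simp only [map_sub, map_sum, map_smul]
      rw [e1, sub_eq_zero]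
      refine (congrFun hc τ).symm.trans ?_
      simp only [Matrix.mulVec, dotProduct]
      exact Finset.sum_congr rfl fun j _ => mul_comm _ _
    have h6 : S g y = ∑ j, c j • S (f j) y := by
      have := h3 _ h5
      rw [← evalAt_apply] at this
      simp only [map_sub, map_sum, map_smul, sub_eq_zero] at this
      exact this
    have h7 : ∀ z : SmoothSection V F₀ E₀, localRep x z v =
        (trivializationAt F₀ E₀ x).continuousLinearMapAt ℝ y (z y) := fun z =>
      ((trivializationAt F₀ E₀ x).continuousLinearMapAt_apply_of_mem ℝ h4.2 _).symm
    rw [h7, h6]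
    simp only [map_sum, map_smul, ← h7, c, Matrix.mulVec, dotProduct, Finset.sum_smul,
      Finset.smul_sum, smul_smul]
    rw [Finset.sum_comm]
    refine Finset.sum_congr rfl fun τ _ => Finset.sum_congr rfl fun j _ => ?_
    rw [mul_comm]
    rfl

variable [FiniteDimensional ℝ V] [T2Space X] [FiniteDimensional ℝ F] [FiniteDimensional ℝ F₀]

variable (V F E) in
/-- Coordinates on the fibres of `J_k(E)` near `x`: finitely many pointwise independent scalar
operators, given by linear functionals of the derivatives in the chart around `x`, whose common
zeros are the sections with vanishing `k`-jet. -/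
theorem exists_jetCoordinates (k : ℕ) (x : X) :
    ∃ (p : ℕ) (l : Fin p → (∀ j : Fin (k + 1), V [×(j : ℕ)]→L[ℝ] F) →L[ℝ] ℝ)
      (Q : Fin p → ScalarOp V F E), (∀ τ, IsDiffOp k (Q τ)) ∧ ∀ᶠ y in 𝓝 x,
        (∀ τ f, (Q τ f y : ℝ) = l τ fun j => iteratedFDeriv ℝ j (localRep x f) (chartAt V x y)) ∧
        (∀ f, jet k y f = 0 ↔ ∀ τ, Q τ f y = 0) ∧ ∀ c : Fin p → ℝ, ∃ f, ∀ τ, Q τ f y = c τ := by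
  let W : Submodule ℝ (∀ j : Fin (k + 1), V [×(j : ℕ)]→L[ℝ] F) :=
    Submodule.pi Set.univ fun j => symTensor V F j
  have : FiniteDimensional ℝ W := FiniteDimensional.finiteDimensional_submodule W
  let b := Module.finBasis ℝ W
  have hl : ∀ τ, ∃ l : (∀ j : Fin (k + 1), V [×(j : ℕ)]→L[ℝ] F) →L[ℝ] ℝ,
      ∀ J : W, l J = b.coord τ J := by
    intro τ
    obtain ⟨g, hg⟩ := LinearMap.exists_extend (b.coord τ)
    exact ⟨LinearMap.toContinuousLinearMap g, fun J => congrArg (fun h => h J) hg⟩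
  choose l hl using hl
  choose Q hQ hQl using fun τ => exists_scalarOp (E := E) k x (l τ)
  refine ⟨_, l, Q, hQ, ?_⟩
  obtain ⟨N, hN, H⟩ := exists_localRep_eqOn (V := V) F E (x := x) (O := Set.univ) univ_mem
  filter_upwards [eventually_all.2 hQl,
    (isOpen_coordDomain (V := V) (F := F) (E := E) x).eventually_mem (mem_coordDomain_self x),
    eventually_chart (mem_chart_source V x) (eventually_mem_nhds_iff.2 hN)] with y h1 hy hyN
  refine ⟨h1, fun f => ?_, fun c => ?_⟩
  · have hW : (fun j : Fin (k + 1) => iteratedFDeriv ℝ j (localRep x f) (chartAt V x y)) ∈ W :=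
      Submodule.mem_pi.2 fun j _ =>
        iteratedFDeriv_mem_symTensor _ (eventually_contDiffAt_localRep hy f)
    rw [jet_eq_zero_iff, mem_flat_iff_of_mem hy]
    constructor
    · intro h τ
      rw [h1 τ f]
      have : (fun j : Fin (k + 1) => iteratedFDeriv ℝ j (localRep x f) (chartAt V x y)) = 0 :=
        funext fun j => h j j.2
      rw [this, map_zero]
    · intro h
      have : (⟨_, hW⟩ : W) = 0 := b.ext_elem fun τ => by
        rw [map_zero, ← b.coord_apply, ← hl τ]
        simpa [h1 τ f] using h τ
      intro j hj
      exact congrFun (congrArg Subtype.val this) ⟨j, hj⟩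
  · let J : W := b.equivFun.symm c
    obtain ⟨h, hh, hJ⟩ := exists_contDiff_iteratedFDeriv_eq (V := V) (F := F) k
      (fun j => if hj : j < k + 1 then J.1 ⟨j, hj⟩ else 0) (fun j hj => by
        simp only [Nat.lt_succ_of_le hj, dif_pos]
        exact Submodule.mem_pi.1 J.2 ⟨j, Nat.lt_succ_of_le hj⟩ trivial) (chartAt V x y)
    obtain ⟨f, hf⟩ := H h fun v _ => hh.contDiffAt
    refine ⟨f, fun τ => ?_⟩
    rw [h1 τ f]
    have : (fun j : Fin (k + 1) => iteratedFDeriv ℝ j (localRep x f) (chartAt V x y)) = J.1 := by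
      funext j
      rw [((hf.eventuallyEq_of_mem hyN).iteratedFDeriv ℝ j).eq_of_nhds,
        hJ j (Nat.lt_succ_iff.1 j.2), dif_pos j.2]
    rw [this, hl τ J, b.coord_apply, ← b.equivFun_apply, LinearEquiv.apply_symm_apply]

/-- In coordinates, a differential operator of order `≤ k` is a linear combination of the
derivatives of order `≤ k` with smooth coefficients. -/
theorem IsDiffOp.exists_local_expression {k : ℕ}
    {D : SmoothSection V F E →ₗ[ℝ] SmoothSection V F₀ E₀} (hD : IsDiffOp k D) (x : X) :
    ∃ A : ∀ j : Fin (k + 1), V → (V [×(j : ℕ)]→L[ℝ] F) →L[ℝ] F₀,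
      (∀ j, ∀ᶠ v in 𝓝 (chartAt V x x), ContDiffAt ℝ ∞ (A j) v) ∧
      ∀ᶠ v in 𝓝 (chartAt V x x), ∀ f,
        localRep x (D f) v = ∑ j, A j v (iteratedFDeriv ℝ j (localRep x f) v) := by
  obtain ⟨p, l, Q, -, h⟩ := exists_jetCoordinates V F E k x
  obtain ⟨s, hs, hsum⟩ := exists_expansion h.self_of_nhds.2.2 D
    (h.mono fun y hy f hf => hD y f ((hy.2.1 f).2 hf))
  let ι : ∀ j : Fin (k + 1), (V [×(j : ℕ)]→L[ℝ] F) →L[ℝ]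
      (∀ j : Fin (k + 1), V [×(j : ℕ)]→L[ℝ] F) := fun j =>
    ContinuousLinearMap.single ℝ (fun j : Fin (k + 1) => V [×(j : ℕ)]→L[ℝ] F) j
  refine ⟨fun j v => ∑ τ, ((l τ).comp (ι j)).smulRight (s τ v), fun j => ?_, ?_⟩
  · filter_upwards [eventually_all.2 hs] with v hv
    refine ContDiffAt.sum fun τ _ => ?_
    exact contDiffAt_const.smulRight (hv τ)
  · filter_upwards [hsum, eventually_chart_symm (mem_chart_source V x) h] with v h1 h2 f
    rw [h1 f]
    obtain ⟨hv, h3, -⟩ := h2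
    simp only [sum_apply, ContinuousLinearMap.smulRight_apply]
    rw [Finset.sum_comm]
    refine Finset.sum_congr rfl fun τ _ => ?_
    rw [← Finset.sum_smul]
    congr 1
    rw [localRep_scalar, h3, (chartAt V x).right_inv hv]
    simp only [ContinuousLinearMap.comp_apply, ← map_sum]
    congr 1
    ext1 j
    simp [ι, Finset.sum_apply]

theorem IsDiffOp.map_mem_flat {k : ℕ} {D : SmoothSection V F E →ₗ[ℝ] SmoothSection V F₀ E₀}
    (hD : IsDiffOp k D) {r : ℕ} {x : X} {f : SmoothSection V F E} (hf : f ∈ flat (k + r) x) :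
    D f ∈ flat r x := by
  obtain ⟨A, hA, h⟩ := hD.exists_local_expression x
  have hc := contDiffAt_localRep_chart (mem_coordDomain_self x) f
  refine mem_flat_iff.2 (VanishTo.congr (VanishTo.sum (s := Finset.univ) (fun j _ => ?_)
    (fun j _ => ?_)) (h.mono fun v hv => hv f))
  · exact (hA j).self_of_nhds.clm_apply (hc.iteratedFDeriv_infty j)
  · exact VanishTo.clm_apply
      (VanishTo.iteratedFDeriv (r := r) ((mem_flat_iff.1 hf).mono (by have := j.2; omega)))
      (hA j).self_of_nhds (hc.iteratedFDeriv_infty j)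

theorem exists_dirDeriv (x : X) (a : V) (f : SmoothSection V F E) :
    ∃ g : SmoothSection V F E,
      localRep x g =ᶠ[𝓝 (chartAt V x x)] fun v => fderiv ℝ (localRep x f) v a :=
  exists_localRep_eventuallyEq F E
    ((eventually_contDiffAt_localRep (mem_coordDomain_self x) f).mono fun _ hv =>
      hv.fderiv_apply_infty a)

/-- A section that near `x` is the derivative of `f` in the direction `a`, in the chart and
trivialization around `x`. -/
noncomputable def dirDeriv (x : X) (a : V) (f : SmoothSection V F E) : SmoothSection V F E :=
  (exists_dirDeriv x a f).choose

theorem localRep_dirDeriv (x : X) (a : V) (f : SmoothSection V F E) :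
    localRep x (dirDeriv x a f) =ᶠ[𝓝 (chartAt V x x)] fun v => fderiv ℝ (localRep x f) v a :=
  (exists_dirDeriv x a f).choose_spec

theorem derivAt_apply (m : ℕ) (x : X) (f : SmoothSection V F E) :
    derivAt m x f = iteratedFDeriv ℝ m (localRep x f) (chartAt V x x) := rfl

theorem derivAt_dirDeriv (m : ℕ) (x : X) (a : V) (f : SmoothSection V F E) :
    derivAt m x (dirDeriv x a f) = contract a (derivAt (m + 1) x f) := by
  rw [derivAt_apply, ((localRep_dirDeriv x a f).iteratedFDeriv ℝ m).eq_of_nhds,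
    iteratedFDeriv_fderiv_apply a m (eventually_contDiffAt_localRep (mem_coordDomain_self x) f)]
  rfl

/-- A differential operator of order `≤ k` commutes with directional derivatives up to an operator
of order `≤ k`. -/
theorem IsDiffOp.commutator_mem_flat {k : ℕ} {D : SmoothSection V F E →ₗ[ℝ] SmoothSection V F₀ E₀}
    (hD : IsDiffOp k D) {r : ℕ} {x : X} (a : V) {f : SmoothSection V F E}
    (hf : f ∈ flat (k + r) x) : D (dirDeriv x a f) - dirDeriv x a (D f) ∈ flat r x := by
  obtain ⟨A, hA, h⟩ := hD.exists_local_expression x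
  set p := chartAt V x x
  have hcf := eventually_contDiffAt_localRep (mem_coordDomain_self x) f
  have hAc : ∀ᶠ v in 𝓝 p, ∀ j, ContDiffAt ℝ ∞ (A j) v := eventually_all.2 hA
  have e1 : localRep x (D f) =ᶠ[𝓝 p]
      fun v => ∑ j, A j v (iteratedFDeriv ℝ j (localRep x f) v) := h.mono fun v hv => hv f
  have e2 : ∀ᶠ v in 𝓝 p, localRep x (D (dirDeriv x a f) - dirDeriv x a (D f)) v =
      ∑ j, (-(fderiv ℝ (A j) v a)) (iteratedFDeriv ℝ j (localRep x f) v) := by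
    have hs : localRep x (D (dirDeriv x a f) - dirDeriv x a (D f)) =ᶠ[𝓝 p]
        localRep x (D (dirDeriv x a f)) + localRep x ((-1 : ℝ) • dirDeriv x a (D f)) := by
      rw [sub_eq_add_neg, ← neg_one_smul ℝ (dirDeriv x a (D f))]
      exact localRep_add_eventuallyEq (mem_coordDomain_self x) _ _
    filter_upwards [hs, localRep_smul_eventuallyEq (mem_coordDomain_self x) (-1)
      (dirDeriv x a (D f)), h, localRep_dirDeriv x a (D f),
      (localRep_dirDeriv x a f).eventually_nhds, e1.eventually_nhds, hcf.eventually_nhds, hAc]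
      with v h1 h2 h3 h4 h5 h6 h7 h8
    rw [h1, Pi.add_apply, h2, Pi.smul_apply, h3, h4, EventuallyEq.fderiv_eq h6]
    have h9 : ∀ j : Fin (k + 1), HasFDerivAt (iteratedFDeriv ℝ j (localRep x f))
        (fderiv ℝ (iteratedFDeriv ℝ j (localRep x f)) v) v := fun j =>
      ((h7.self_of_nhds.iteratedFDeriv_infty j).differentiableAt (by simp)).hasFDerivAt
    have h10 : ∀ j, HasFDerivAt (A j) (fderiv ℝ (A j) v) v := fun j =>
      ((h8 j).differentiableAt (by simp)).hasFDerivAt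
    have h11 := (HasFDerivAt.fun_sum (u := Finset.univ) fun j _ => (h10 j).clm_apply (h9 j)).fderiv
    rw [h11, sum_apply, Finset.smul_sum, ← Finset.sum_add_distrib]
    refine Finset.sum_congr rfl fun j _ => ?_
    rw [(EventuallyEq.iteratedFDeriv ℝ h5 j).eq_of_nhds, iteratedFDeriv_fderiv_apply a j h7,
      contract_iteratedFDeriv]
    simp
  refine mem_flat_iff.2 (VanishTo.congr (VanishTo.sum (s := Finset.univ) (fun j _ => ?_)
    (fun j _ => ?_)) e2)
  · exact ((hA j).self_of_nhds.fderiv_apply_infty a).neg.clm_apply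
      (hcf.self_of_nhds.iteratedFDeriv_infty j)
  · exact VanishTo.clm_apply
      (VanishTo.iteratedFDeriv (r := r) ((mem_flat_iff.1 hf).mono (by have := j.2; omega)))
      ((hA j).self_of_nhds.fderiv_apply_infty a).neg (hcf.self_of_nhds.iteratedFDeriv_infty j)

theorem derivAt_mem_symTensor (m : ℕ) (x : X) (f : SmoothSection V F E) :
    derivAt m x f ∈ symTensor V F m :=
  iteratedFDeriv_mem_symTensor m (eventually_contDiffAt_localRep (mem_coordDomain_self x) f)

variable (E) in
theorem exists_mem_flat_derivAt_eq {m : ℕ} (x : X) {T : V [×m]→L[ℝ] F} (hT : T ∈ symTensor V F m) :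
    ∃ f : SmoothSection V F E, f ∈ flat m x ∧ derivAt m x f = T := by
  obtain ⟨h, hh, hJ⟩ := exists_contDiff_iteratedFDeriv_eq (V := V) (F := F) m
    (Pi.single m T) (fun j hj => by
      rcases eq_or_ne j m with rfl | hne
      · simpa using hT
      · simp [hne]) (chartAt V x x)
  obtain ⟨f, hf⟩ := exists_localRep_eventuallyEq F E (x := x)
    (Eventually.of_forall fun v => hh.contDiffAt (x := v))
  refine ⟨f, mem_flat_iff.2 (VanishTo.congr (fun j hj => ?_) hf), ?_⟩
  · rw [hJ j hj.le, Pi.single_eq_of_ne hj.ne]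
  · rw [derivAt_apply, (hf.iteratedFDeriv ℝ m).eq_of_nhds, hJ m le_rfl, Pi.single_eq_same]

theorem mem_flat_succ_iff {m : ℕ} {x : X} {f : SmoothSection V F E} :
    f ∈ (flat (m + 1) x : Submodule ℝ (SmoothSection V F E)) ↔
      f ∈ (flat m x : Submodule ℝ (SmoothSection V F E)) ∧ derivAt m x f = 0 := by
  rw [mem_flat_iff, mem_flat_iff]
  refine ⟨fun h => ⟨h.mono m.le_succ, h m m.lt_succ_self⟩, fun h i hi => ?_⟩
  rcases Nat.lt_succ_iff_lt_or_eq.1 hi with hi | rfl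
  exacts [h.1 i hi, h.2]

theorem dirDeriv_mem_flat {m : ℕ} {x : X} (a : V) {f : SmoothSection V F E}
    (hf : f ∈ flat (m + 1) x) : dirDeriv x a f ∈ flat m x := by
  refine mem_flat_iff.2 fun i hi => ?_
  rw [← derivAt_apply, derivAt_dirDeriv, derivAt_apply, mem_flat_iff.1 hf (i + 1) (by omega),
    map_zero]

end DifferentialOperators

/-! ### Prolongations and subbundles -/

section Prolongations

set_option linter.unusedSectionVars false

variable {V : Type*} [NormedAddCommGroup V] [NormedSpace ℝ V] [FiniteDimensional ℝ V]
  {X : Type*} [TopologicalSpace X] [T2Space X] [ChartedSpace V X] [IsManifold 𝓘(ℝ, V) ∞ X]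
  {F : Type*} [NormedAddCommGroup F] [NormedSpace ℝ F] [FiniteDimensional ℝ F]
  {E : X → Type*} [TopologicalSpace (TotalSpace F E)] [∀ x, TopologicalSpace (E x)]
  [∀ x, AddCommGroup (E x)] [∀ x, Module ℝ (E x)] [FiberBundle F E] [VectorBundle ℝ F E]
  [ContMDiffVectorBundle ∞ F E 𝓘(ℝ, V)]
  {F₀ : Type*} [NormedAddCommGroup F₀] [NormedSpace ℝ F₀] [FiniteDimensional ℝ F₀]
  {E₀ : X → Type*} [TopologicalSpace (TotalSpace F₀ E₀)] [∀ x, TopologicalSpace (E₀ x)]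
  [∀ x, AddCommGroup (E₀ x)] [∀ x, Module ℝ (E₀ x)] [FiberBundle F₀ E₀] [VectorBundle ℝ F₀ E₀]
  [ContMDiffVectorBundle ∞ F₀ E₀ 𝓘(ℝ, V)]

/-- The product of a scalar operator with a smooth function. -/
noncomputable def mulOp (a : SmoothSection V ℝ (Bundle.Trivial X ℝ)) (P : ScalarOp V F E) :
    ScalarOp V F E where
  toFun f := scalarSection (fun y => (a y : ℝ) * P f y) ((contMDiff_scalar a).mul
    (contMDiff_scalar (P f)))
  map_add' f g := by
    ext y
    change (a y : ℝ) * P (f + g) y = (a y : ℝ) * P f y + (a y : ℝ) * P g y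
    rw [map_add, ← mul_add]
    rfl
  map_smul' c f := by
    ext y
    change (a y : ℝ) * P (c • f) y = c * ((a y : ℝ) * P f y)
    rw [map_smul, mul_left_comm]
    rfl

/-- A combination with smooth coefficients of the values of the `P_τ` vanishes to the same order as
these. -/
theorem mem_flat_of_expansion {p m : ℕ} {P : Fin p → ScalarOp V F E} {x : X}
    {S : SmoothSection V F E →ₗ[ℝ] SmoothSection V F₀ E₀} {s : Fin p → V → F₀}
    (hs : ∀ τ, ∀ᶠ v in 𝓝 (chartAt V x x), ContDiffAt ℝ ∞ (s τ) v)
    (h : ∀ᶠ v in 𝓝 (chartAt V x x), ∀ f,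
      localRep x (S f) v = ∑ τ, localRep x (P τ f) v • s τ v) {f : SmoothSection V F E}
    (hf : ∀ τ, P τ f ∈ flat m x) : S f ∈ flat m x := by
  have hc : ∀ τ, ContDiffAt ℝ ∞ (localRep x (P τ f)) (chartAt V x x) := fun τ =>
    contDiffAt_localRep_chart (mem_coordDomain_self x) _
  refine mem_flat_iff.2 (VanishTo.congr (VanishTo.sum (s := Finset.univ) (fun τ _ => ?_)
    (fun τ _ => ?_)) (h.mono fun v hv => hv f))
  · exact (hc τ).smul (hs τ).self_of_nhds
  · exact (mem_flat_iff.1 (hf τ)).bilinear (ContinuousLinearMap.lsmul ℝ ℝ).flip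
      (hs τ).self_of_nhds (hc τ)

/-- The prolongations of `R = ker Φ` are the kernels of the prolongations of `Φ`. -/
theorem IsQuotientOperator.forall_equation_iff {q : ℕ} {R : ∀ x : X, Submodule ℝ (Jet V F E q x)}
    {D : SmoothSection V F E →ₗ[ℝ] SmoothSection V F₀ E₀} (hD : IsQuotientOperator R D) {r : ℕ}
    {x : X} {f : SmoothSection V F E} :
    (∀ P, IsEquation R P → P f ∈ flat r x) ↔ D f ∈ flat r x := by
  obtain ⟨p, l, Q, hQ, hQx⟩ := exists_jetCoordinates V F₀ E₀ 0 x
  have hQ0 : ∀ τ (y : X) (z : SmoothSection V F₀ E₀), z y = 0 → Q τ z y = 0 := fun τ y z hz =>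
    hQ τ y z (jet_eq_zero_iff.2 (mem_flat_one_iff.2 hz))
  constructor
  · intro h
    obtain ⟨s, hs, hexp⟩ := exists_expansion hQx.self_of_nhds.2.2
      (LinearMap.id : SmoothSection V F₀ E₀ →ₗ[ℝ] SmoothSection V F₀ E₀)
      (hQx.mono fun y hy z hz => mem_flat_one_iff.1 (jet_eq_zero_iff.1 ((hy.2.1 z).2 hz)))
    refine mem_flat_of_expansion hs hexp fun τ => h (Q τ ∘ₗ D) ⟨fun y g hg => ?_, fun y g hg => ?_⟩
    · refine hQ0 τ y _ ((hD.2.1 y g).1 ?_)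
      rw [hg]
      exact Submodule.zero_mem _
    · exact hQ0 τ y _ ((hD.2.1 y g).1 hg)
  · intro h P hP
    obtain ⟨s, hs, hexp⟩ := exists_expansion (P := fun τ => Q τ ∘ₗ D) (x := x) (fun c => by
        obtain ⟨z, hz⟩ := hQx.self_of_nhds.2.2 c
        obtain ⟨g, hg⟩ := hD.2.2 x (z x)
        refine ⟨g, fun τ => ?_⟩
        rw [← hz τ]
        have h0 : (D g - z) x = 0 := sub_eq_zero.2 hg
        have h1 := hQ0 τ x _ h0
        rw [map_sub] at h1
        exact sub_eq_zero.1 h1) P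
      (hQx.mono fun y hy g hg => hP.2 y g ((hD.2.1 y g).2
        (mem_flat_one_iff.1 (jet_eq_zero_iff.1 ((hy.2.1 _).2 hg)))))
    refine mem_flat_of_expansion hs hexp fun τ => ?_
    exact (hQ τ).map_mem_flat (by rwa [zero_add])

theorem mem_prolong_iff {k : ℕ} {R : ∀ x : X, Submodule ℝ (Jet V F E k x)} {r : ℕ} {x : X}
    {f : SmoothSection V F E} :
    jet (k + r) x f ∈ prolong R r x ↔ ∀ P, IsEquation R P → P f ∈ flat (r + 1) x := by
  simp only [prolong, Submodule.mem_map, Submodule.mem_iInf, LinearMap.mem_ker, Subtype.forall,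
    LinearMap.comp_apply, jet_eq_zero_iff]
  constructor
  · rintro ⟨g, hg, e⟩ P hP
    have h1 : P (g - f) ∈ flat (r + 1) x := hP.1.map_mem_flat (jet_eq_iff.1 e)
    rw [map_sub] at h1
    exact (Submodule.sub_mem_iff_right _ (hg P hP)).1 h1
  · exact fun h => ⟨f, h, rfl⟩

theorem IsQuotientOperator.mem_prolong_iff {q : ℕ} {R : ∀ x : X, Submodule ℝ (Jet V F E q x)}
    {D : SmoothSection V F E →ₗ[ℝ] SmoothSection V F₀ E₀} (hD : IsQuotientOperator R D) {r : ℕ}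
    {x : X} {f : SmoothSection V F E} :
    jet (q + r) x f ∈ prolong R r x ↔ D f ∈ flat (r + 1) x :=
  FormalPDE.mem_prolong_iff.trans hD.forall_equation_iff

theorem mem_jetImage_iff {D : SmoothSection V F E →ₗ[ℝ] SmoothSection V F₀ E₀} {r : ℕ} {x : X}
    {z : SmoothSection V F₀ E₀} :
    jet r x z ∈ jetImage D r x ↔ ∃ f, z - D f ∈ flat (r + 1) x := by
  simp only [jetImage, LinearMap.mem_range, LinearMap.comp_apply]
  exact exists_congr fun f => by rw [eq_comm, jet_eq_iff]

theorem isEquation_jetImage_iff {D : SmoothSection V F E →ₗ[ℝ] SmoothSection V F₀ E₀} {k : ℕ}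
    {P : ScalarOp V F₀ E₀} : IsEquation (jetImage D k) P ↔ IsCC k D P := by
  refine and_congr_right fun hP => ⟨fun h f => ?_, fun h x z hz => ?_⟩
  · ext x
    exact h x (D f) ⟨f, rfl⟩
  · obtain ⟨f, hf⟩ := mem_jetImage_iff.1 hz
    have h1 := hP x _ (jet_eq_zero_iff.2 hf)
    rw [map_sub, h f, sub_zero] at h1
    exact h1

theorem jet_submodule_ext {k : ℕ} {x : X} {A B : Submodule ℝ (Jet V F E k x)}
    (h : ∀ f, jet k x f ∈ A ↔ jet k x f ∈ B) : A = B := by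
  ext j
  obtain ⟨f, rfl⟩ := Submodule.mkQ_surjective _ j
  exact h f

/-- A vector subbundle of the jet bundle is defined by its global equations. -/
theorem IsSubbundle.mem_of_forall_equation {k : ℕ} {R : ∀ x : X, Submodule ℝ (Jet V F E k x)}
    (hR : IsSubbundle R) {x : X} {f : SmoothSection V F E} (h : ∀ P, IsEquation R P → P f x = 0) :
    jet k x f ∈ R x := by
  obtain ⟨p, P, hP, hx⟩ := hR x
  obtain ⟨U, hU, hUo, hxU⟩ := eventually_nhds_iff.1 hx
  obtain ⟨χ, hχ, hsupp, h1⟩ := exists_bump V (hUo.mem_nhds hxU)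
  refine ((hx.self_of_nhds.1 f).2 fun τ => ?_)
  have h2 : ∀ y g, (mulOp (scalarSection χ hχ) (P τ) g y : ℝ) = χ y * P τ g y := fun y g => rfl
  have h3 := h (mulOp (scalarSection χ hχ) (P τ)) ⟨fun y g hg => ?_, fun y g hg => ?_⟩
  · rw [h2, h1.self_of_nhds, one_mul] at h3
    exact h3
  · rw [h2, hP τ y g hg]
    exact mul_zero _
  · rw [h2]
    by_cases hy : y ∈ U
    · rw [((hU y hy).1 g).1 hg τ]
      exact mul_zero _
    · rw [image_eq_zero_of_notMem_tsupport fun h => hy (hsupp h), zero_mul]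

theorem evalAt_comp_sub_sum {p : ℕ} (P : ScalarOp V F E) (f : SmoothSection V F E)
    (g : Fin p → SmoothSection V F E) (c : Fin p → ℝ) (y : X) :
    (P (f - ∑ j, c j • g j) y : ℝ) = P f y - ∑ j, c j * P (g j) y := by
  rw [← evalAt_apply]
  simp only [map_sub, map_sum, map_smul]
  rfl

/-- Linearly independent columns can be completed by constant columns to an invertible matrix. -/
theorem exists_completion {N p : ℕ} {v : Fin p → Fin N → ℝ} (hv : LinearIndependent ℝ v) :
    ∃ (p' : ℕ) (u : Fin p' → Fin N → ℝ) (e : Fin N ≃ Fin p ⊕ Fin p'),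
      (Matrix.of fun a b => Sum.elim v u b (e.symm a)).det ≠ 0 := by
  obtain ⟨C, hC⟩ := Submodule.exists_isCompl (Submodule.span ℝ (Set.range v))
  let b := Module.finBasis ℝ C
  let u : Fin (Module.finrank ℝ C) → Fin N → ℝ := fun t => b t
  have hu : LinearIndependent ℝ u := b.linearIndependent.map' C.subtype (by simp)
  have hr : Submodule.span ℝ (Set.range u) = C := by
    have : Set.range u = C.subtype '' Set.range b := by rw [← Set.range_comp]; rfl
    rw [this, Submodule.span_image, b.span_eq, Submodule.map_top, Submodule.range_subtype]
  have hi : LinearIndependent ℝ (Sum.elim v u) := hv.sum_type hu (by rw [hr]; exact hC.disjoint)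
  have hcard : Fintype.card (Fin p ⊕ Fin (Module.finrank ℝ C)) = N := by
    have h1 := finrank_span_eq_card hi
    rw [Set.Sum.elim_range, Submodule.span_union, hr, hC.sup_eq_top, finrank_top] at h1
    simpa using h1.symm
  obtain ⟨e⟩ := Fintype.card_eq.1 ((Fintype.card_fin N).trans hcard.symm)
  refine ⟨_, u, e, isUnit_iff_ne_zero.1 ((Matrix.isUnit_iff_isUnit_det _).1 ?_)⟩
  rw [← Matrix.linearIndependent_cols_iff_isUnit]
  exact hi.map' (LinearEquiv.funCongrLeft ℝ ℝ e.symm).toLinearMap (LinearEquiv.ker _)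

/-- If the kernel of the bundle map `J_m(E) → J_k(E₀)` induced by `D` is a vector subbundle, then so
is its image. -/
theorem isSubbundle_jetImage {D : SmoothSection V F E →ₗ[ℝ] SmoothSection V F₀ E₀} {m k : ℕ}
    {R : ∀ x : X, Submodule ℝ (Jet V F E m x)} (hR : IsSubbundle R)
    (h : ∀ y f, jet m y f ∈ R y ↔ jet k y (D f) = 0) : IsSubbundle (jetImage D k) := by
  intro x
  obtain ⟨p, P, hP, hx⟩ := hR x
  obtain ⟨N, l, Q, hQ, hQx⟩ := exists_jetCoordinates V F₀ E₀ k x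
  choose f hf using fun j : Fin p => hx.self_of_nhds.2 (Pi.single j 1)
  have hind : LinearIndependent ℝ fun (j : Fin p) (i : Fin N) => (Q i (D (f j)) x : ℝ) := by
    refine Fintype.linearIndependent_iff.2 fun c hc τ => ?_
    have h1 : jet k x (D (0 - ∑ j, c j • f j)) = 0 := by
      refine (hQx.self_of_nhds.2.1 _).2 fun i => ?_
      refine (evalAt_comp_sub_sum (Q i ∘ₗ D) 0 f c x).trans ?_
      have := congrFun hc i
      simp only [Finset.sum_apply, Pi.smul_apply, smul_eq_mul, Pi.zero_apply] at this
      simp only [map_zero, LinearMap.comp_apply, this]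
      exact sub_zero _
    have h2 := (hx.self_of_nhds.1 _).1 ((h x _).2 h1) τ
    rw [evalAt_comp_sub_sum] at h2
    simp only [map_zero, hf, Pi.single_apply, mul_ite, mul_one, mul_zero, Finset.sum_ite_eq,
      Finset.mem_univ, if_true] at h2
    exact neg_eq_zero.1 ((zero_sub _).symm.trans h2)
  obtain ⟨p', u, e, hdet⟩ := exists_completion hind
  let Z : V → Matrix (Fin p ⊕ Fin p') (Fin p ⊕ Fin p') ℝ := fun v => Matrix.of fun a b =>
    Sum.elim (fun j => localRep x (Q (e.symm a) (D (f j))) v) (fun t => u t (e.symm a)) b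
  have hZc : ∀ᶠ v in 𝓝 (chartAt V x x), ∀ a b, ContDiffAt ℝ ∞ (fun v => Z v a b) v := by
    refine eventually_all.2 fun a => eventually_all.2 fun b => ?_
    rcases b with j | t
    · exact eventually_contDiffAt_localRep (mem_coordDomain_self x) _
    · exact Eventually.of_forall fun v => contDiffAt_const
  have hZx : (Z (chartAt V x x)).det ≠ 0 := by
    convert! hdet using 2
    ext a b
    rcases b with j | t
    · exact localRep_scalar_chart (mem_chart_source V x) _
    · rfl
  have hZdet : ∀ᶠ v in 𝓝 (chartAt V x x), (Z v).det ≠ 0 :=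
    (contDiffAt_matrix_det hZc.self_of_nhds).continuousAt.eventually_ne hZx
  -- The equations of the image are the last rows of the inverse of the completed matrix.
  choose α hα using fun (t : Fin p') (a : Fin p ⊕ Fin p') => exists_scalar_eventuallyEq
    (X := X) (x := x) (h := fun v => (Z v)⁻¹ (Sum.inr t) a)
    ((hZc.and hZdet).mono fun v hv => contDiffAt_matrix_inv hv.1 hv.2 _ _)
  let P' : Fin p' → ScalarOp V F₀ E₀ := fun t => ∑ a, mulOp (α t a) (Q (e.symm a))
  have hP' : ∀ t z y, (P' t z y : ℝ) = ∑ a, (α t a y : ℝ) * Q (e.symm a) z y := fun t z y => by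
    rw [← evalAt_apply]
    simp only [P', LinearMap.sum_apply, map_sum]
    rfl
  refine ⟨p', P', fun t y z hz => ?_, ?_⟩
  · refine (hP' t z y).trans (Finset.sum_eq_zero fun a _ => ?_)
    rw [hQ (e.symm a) y z hz]
    exact mul_zero _
  -- Near `x`, every section is modulo `R` a combination of the `f_j`.
  let G : V → Matrix (Fin p) (Fin p) ℝ := fun v τ j => localRep x (P τ (f j)) v
  have hGdet : ∀ᶠ v in 𝓝 (chartAt V x x), (G v).det ≠ 0 := by
    refine (contDiffAt_matrix_det fun τ j => ?_).continuousAt.eventually_ne ?_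
    · exact contDiffAt_localRep_chart (mem_coordDomain_self x) _
    · have : G (chartAt V x x) = 1 := by
        ext τ j
        simp only [G]
        rw [localRep_scalar_chart (mem_chart_source V x), hf, Matrix.one_apply, Pi.single_apply]
      simp [this]
  filter_upwards [hx, hQx, eventually_chart (mem_chart_source V x) hZdet,
    eventually_chart (mem_chart_source V x) hGdet, eventually_all.2 fun t =>
    eventually_all.2 fun a => hα t a, (chartAt V x).open_source.eventually_mem
    (mem_chart_source V x)] with y h1 h2 hZy hGy hαy hy
  have hZ1 : ∀ a j, Z (chartAt V x y) a (Sum.inl j) = Q (e.symm a) (D (f j)) y := fun a j =>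
    localRep_scalar_chart hy _
  have hG1 : ∀ τ j, G (chartAt V x y) τ j = P τ (f j) y := fun τ j => localRep_scalar_chart hy _
  set Zy := Z (chartAt V x y)
  set Gy := G (chartAt V x y)
  let w : SmoothSection V F₀ E₀ → Fin p ⊕ Fin p' → ℝ := fun z a => Q (e.symm a) z y
  have hw : ∀ t z, (P' t z y : ℝ) = Zy⁻¹.mulVec (w z) (Sum.inr t) := fun t z => by
    rw [hP']
    exact Finset.sum_congr rfl fun a _ => by rw [hαy]
  have hcancel : ∀ c, Zy⁻¹.mulVec (Zy.mulVec c) = c := fun c => by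
    rw [Matrix.mulVec_mulVec, Matrix.nonsing_inv_mul _ (isUnit_iff_ne_zero.2 hZy),
      Matrix.one_mulVec]
  have hcancel' : ∀ c, Zy.mulVec (Zy⁻¹.mulVec c) = c := fun c => by
    rw [Matrix.mulVec_mulVec, Matrix.mul_nonsing_inv _ (isUnit_iff_ne_zero.2 hZy),
      Matrix.one_mulVec]
  have hdiff : ∀ z (c : Fin p → ℝ), z - D (∑ j, c j • f j) ∈ flat (k + 1) y ↔
      Zy.mulVec (Sum.elim c 0) = w z := by
    intro z c
    have e1 : ∀ i, (Q i (z - D (∑ j, c j • f j)) y : ℝ) = Q i z y - ∑ j, c j * Q i (D (f j)) y :=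
      fun i => by
        rw [← evalAt_comp_sub_sum, map_sum]
        simp only [map_smul]
    have e2 : ∀ a, Zy.mulVec (Sum.elim c 0) a = ∑ j, c j * Q (e.symm a) (D (f j)) y := fun a => by
      simp only [Matrix.mulVec, dotProduct, Fintype.sum_sum_type, hZ1, Sum.elim_inl, Sum.elim_inr,
        Pi.zero_apply, mul_zero, Finset.sum_const_zero, add_zero]
      exact Finset.sum_congr rfl fun j _ => mul_comm _ _
    rw [← jet_eq_zero_iff, h2.2.1]
    constructor
    · intro h0
      funext a
      rw [e2]
      exact (sub_eq_zero.1 ((e1 _).symm.trans (h0 (e.symm a)))).symm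
    · intro h0 i
      refine (e1 i).trans (sub_eq_zero.2 ?_)
      have h3 := congrFun h0 (e i)
      rw [e2] at h3
      simp only [w, Equiv.symm_apply_apply] at h3
      exact h3.symm
  refine ⟨fun z => mem_jetImage_iff.trans ⟨?_, fun h0 => ?_⟩, fun c => ?_⟩
  · rintro ⟨g, hg⟩ t
    let c : Fin p → ℝ := Gy⁻¹.mulVec fun τ => P τ g y
    have hc : Gy.mulVec c = fun τ => (P τ g y : ℝ) := by
      simp only [c, Matrix.mulVec_mulVec, Matrix.mul_nonsing_inv _ (isUnit_iff_ne_zero.2 hGy),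
        Matrix.one_mulVec]
    have h3 : jet m y (g - ∑ j, c j • f j) ∈ R y := by
      refine (h1.1 _).2 fun τ => ?_
      refine (evalAt_comp_sub_sum (P τ) g f c y).trans (sub_eq_zero.2 ?_)
      refine (congrFun hc τ).symm.trans ?_
      simp only [Matrix.mulVec, dotProduct]
      exact Finset.sum_congr rfl fun j _ => by rw [hG1, mul_comm]
    have h4 := jet_eq_zero_iff.1 ((h y _).1 h3)
    have h5 : z - D (∑ j, c j • f j) ∈ flat (k + 1) y := by
      have := Submodule.add_mem _ hg h4
      rwa [map_sub, sub_add_sub_cancel] at this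
    rw [hdiff] at h5
    refine (hw t z).trans ?_
    rw [← h5, hcancel]
    rfl
  · refine ⟨∑ j, Zy⁻¹.mulVec (w z) (Sum.inl j) • f j, (hdiff z _).2 ?_⟩
    conv_rhs => rw [← hcancel' (w z)]
    congr 1
    funext b
    rcases b with j | t
    · rfl
    · exact ((hw t z).symm.trans (h0 t)).symm
  · obtain ⟨z, hz⟩ := h2.2.2 fun i => Zy.mulVec (Sum.elim 0 c) (e i)
    refine ⟨z, fun t => (hw t z).trans ?_⟩
    have : w z = Zy.mulVec (Sum.elim 0 c) := by
      funext a
      refine (hz (e.symm a)).trans ?_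
      rw [Equiv.apply_symm_apply]
    rw [this, hcancel]
    rfl

end Prolongations

/-! ### Compatibility conditions -/

section CompatibilityConditions

set_option linter.unusedSectionVars false

variable {V : Type*} [NormedAddCommGroup V] [NormedSpace ℝ V] [FiniteDimensional ℝ V]
  {X : Type*} [TopologicalSpace X] [T2Space X] [ChartedSpace V X] [IsManifold 𝓘(ℝ, V) ∞ X]
  {F : Type*} [NormedAddCommGroup F] [NormedSpace ℝ F] [FiniteDimensional ℝ F]
  {E : X → Type*} [TopologicalSpace (TotalSpace F E)] [∀ x, TopologicalSpace (E x)]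
  [∀ x, AddCommGroup (E x)] [∀ x, Module ℝ (E x)] [FiberBundle F E] [VectorBundle ℝ F E]
  [ContMDiffVectorBundle ∞ F E 𝓘(ℝ, V)]
  {F₀ : Type*} [NormedAddCommGroup F₀] [NormedSpace ℝ F₀] [FiniteDimensional ℝ F₀]
  {E₀ : X → Type*} [TopologicalSpace (TotalSpace F₀ E₀)] [∀ x, TopologicalSpace (E₀ x)]
  [∀ x, AddCommGroup (E₀ x)] [∀ x, Module ℝ (E₀ x)] [FiberBundle F₀ E₀] [VectorBundle ℝ F₀ E₀]
  [ContMDiffVectorBundle ∞ F₀ E₀ 𝓘(ℝ, V)]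

theorem derivAt_eq_of_sub_mem {m : ℕ} {x : X} {f g : SmoothSection V F E}
    (h : f - g ∈ (flat (m + 1) x : Submodule ℝ (SmoothSection V F E))) :
    derivAt m x f = derivAt m x g := by
  rw [← sub_eq_zero, ← map_sub]
  exact (mem_flat_succ_iff.1 h).2

/-- The symbol is well defined since `D` lowers the order of vanishing by at most `q`; it commutes
with contractions since `D` commutes with directional derivatives up to lower order terms. -/
theorem IsDiffOp.exists_symbolFamily {q : ℕ} {D : SmoothSection V F E →ₗ[ℝ] SmoothSection V F₀ E₀}
    (hD : IsDiffOp q D) (x : X) : ∃ σ : SymbolFamily V F F₀ q, ∀ (r : ℕ) (f : SmoothSection V F E),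
      f ∈ flat (q + r) x → σ.map r (derivAt (q + r) x f) = derivAt r x (D f) := by
  choose g hg using fun r : ℕ => exists_linear_section (derivAt (q + r) x)
    (flat (q + r) x : Submodule ℝ (SmoothSection V F E))
  have key : ∀ (r : ℕ) (f : SmoothSection V F E), f ∈ flat (q + r) x →
      (derivAt r x ∘ₗ D ∘ₗ g r) (derivAt (q + r) x f) = derivAt r x (D f) := by
    intro r f hf
    obtain ⟨h1, h2⟩ := hg r _ ⟨f, hf, rfl⟩
    refine derivAt_eq_of_sub_mem ?_
    rw [LinearMap.comp_apply, ← map_sub]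
    exact hD.map_mem_flat (r := r + 1) (mem_flat_succ_iff.2 ⟨Submodule.sub_mem _ h1 hf,
      (map_sub (derivAt (q + r) x) _ _).trans (sub_eq_zero.2 h2)⟩)
  refine ⟨⟨fun r => derivAt r x ∘ₗ D ∘ₗ g r, fun r T _ => derivAt_mem_symTensor r x _,
    fun r T v hT => ?_⟩, key⟩
  obtain ⟨f, hf, rfl⟩ := exists_mem_flat_derivAt_eq E x hT
  have h1 : contract (k := q + r) v (derivAt (q + (r + 1)) x f) =
      derivAt (q + r) x (dirDeriv x v f) := (derivAt_dirDeriv (q + r) x v f).symm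
  rw [h1, key (r + 1) f hf, key r _ (dirDeriv_mem_flat v hf), ← derivAt_dirDeriv]
  exact (derivAt_eq_of_sub_mem (hD.commutator_mem_flat v hf)).symm

/-- The prolongations `σ_r(Φ)` at `x` of the symbol of the operator `D = Φ ∘ j_q`: they send the
derivatives of order `q + r` of `f` to those of order `r` of `D f` if the former are the first that
do not vanish. -/
noncomputable def IsDiffOp.symbolFamily {q : ℕ}
    {D : SmoothSection V F E →ₗ[ℝ] SmoothSection V F₀ E₀} (hD : IsDiffOp q D) (x : X) :
    SymbolFamily V F F₀ q := (hD.exists_symbolFamily x).choose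

theorem IsDiffOp.symbolFamily_map {q : ℕ} {D : SmoothSection V F E →ₗ[ℝ] SmoothSection V F₀ E₀}
    (hD : IsDiffOp q D) {x : X} {r : ℕ} {f : SmoothSection V F E} (hf : f ∈ flat (q + r) x) :
    (hD.symbolFamily x).map r (derivAt (q + r) x f) = derivAt r x (D f) :=
  (hD.exists_symbolFamily x).choose_spec r f hf

/-- The symbols at `x` of the prolongations of the system `D f = 0` of order `q`, as a family
indexed by the order `m`. For `m < q` the truncated difference `m + 1 - q` is zero and there is no
condition on `D f`. -/
noncomputable def kernelSymbol (q : ℕ) (D : SmoothSection V F E →ₗ[ℝ] SmoothSection V F₀ E₀) (x : X)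
    (m : ℕ) : Submodule ℝ (V [×m]→L[ℝ] F) :=
  (flat m x ⊓ (flat (m + 1 - q) x).comap D).map (derivAt m x)

theorem IsDiffOp.isKernel_kernelSymbol {q : ℕ}
    {D : SmoothSection V F E →ₗ[ℝ] SmoothSection V F₀ E₀} (hD : IsDiffOp q D) (x : X) :
    (hD.symbolFamily x).IsKernel (kernelSymbol q D x) := by
  intro r T
  rw [kernelSymbol, show q + r + 1 - q = r + 1 by omega]
  constructor
  · rintro ⟨f, ⟨hf, hDf⟩, rfl⟩
    exact ⟨derivAt_mem_symTensor _ x f, by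
      rw [hD.symbolFamily_map hf]; exact (mem_flat_succ_iff.1 hDf).2⟩
  · rintro ⟨hT, h0⟩
    obtain ⟨f, hf, rfl⟩ := exists_mem_flat_derivAt_eq E x hT
    rw [hD.symbolFamily_map hf] at h0
    exact ⟨f, ⟨hf, mem_flat_succ_iff.2 ⟨hD.map_mem_flat hf, h0⟩⟩, rfl⟩

theorem IsDiffOp.mem_image_symbolFamily {q : ℕ}
    {D : SmoothSection V F E →ₗ[ℝ] SmoothSection V F₀ E₀} (hD : IsDiffOp q D) {x : X} {r : ℕ}
    {T : V [×r]→L[ℝ] F₀} :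
    T ∈ (hD.symbolFamily x).image r ↔ ∃ f ∈ flat (q + r) x, derivAt r x (D f) = T := by
  constructor
  · rintro ⟨S, hS, rfl⟩
    obtain ⟨f, hf, rfl⟩ := exists_mem_flat_derivAt_eq E x hS
    exact ⟨f, hf, (hD.symbolFamily_map hf).symm⟩
  · rintro ⟨f, hf, rfl⟩
    exact ⟨_, derivAt_mem_symTensor _ x f, hD.symbolFamily_map hf⟩

namespace IsQuotientOperator

variable {q : ℕ} {R : ∀ x : X, Submodule ℝ (Jet V F E q x)}
  {D : SmoothSection V F E →ₗ[ℝ] SmoothSection V F₀ E₀}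

theorem symbol_eq (hD : IsQuotientOperator R D) (x : X) : symbol R x = kernelSymbol q D x q := by
  have : (R x).comap (jet q x) = (flat (q + 1 - q) x).comap D := by
    ext f
    rw [Submodule.mem_comap, Submodule.mem_comap, show q + 1 - q = 1 by omega, mem_flat_one_iff]
    exact hD.2.1 x f
  rw [symbol, kernelSymbol, this]

theorem prolongSymbolOne_kernelSymbol (hD : IsQuotientOperator R D) (x : X) (m : ℕ) (hm : q ≤ m) :
    prolongSymbolOne (kernelSymbol q D x m) = kernelSymbol q D x (m + 1) := by
  obtain ⟨r, rfl⟩ := Nat.exists_eq_add_of_le hm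
  exact SymbolFamily.prolongSymbolOne_kernel (hD.1.isKernel_kernelSymbol x) r

theorem isAcyclic_prolongSymbol_iff (hD : IsQuotientOperator R D) (x : X) (p t : ℕ) :
    IsAcyclic p (prolongSymbol (symbol R x) t) ↔
      ∀ i r, i + 1 ≤ p → DeltaExact (kernelSymbol q D x) i (q + (t + r)) := by
  rw [hD.symbol_eq, prolongSymbol_eq (hD.prolongSymbolOne_kernelSymbol x),
    isAcyclic_iff fun m hm => hD.prolongSymbolOne_kernelSymbol x m (by omega)]
  simp only [Nat.add_assoc]

/-- Formal integrability in terms of sections: a solution up to order `q + r` at `x` agrees to that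
order with a solution up to order `q + r + 1`. -/
theorem exists_solution (hD : IsQuotientOperator R D) (hR : IsFormallyIntegrable R) {r : ℕ} {x : X}
    {f : SmoothSection V F E} (hf : D f ∈ flat (r + 1) x) :
    ∃ g, D g ∈ flat (r + 2) x ∧ f - g ∈ flat (q + r + 1) x := by
  have h := hD.mem_prolong_iff.2 hf
  rw [← (hR r).2 x] at h
  obtain ⟨j, hj, e⟩ := h
  obtain ⟨g, rfl⟩ := Submodule.mkQ_surjective _ j
  exact ⟨g, hD.mem_prolong_iff.1 hj, jet_eq_iff.1 e.symm⟩

/-- An element of `B_{r+1}` that vanishes to order `r + 1` is the jet of some `D f` where `f`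
vanishes to order `q + r + 1`, by formal integrability. -/
theorem derivAt_mem_image (hD : IsQuotientOperator R D) (hR : IsFormallyIntegrable R) {r : ℕ}
    {x : X} {z : SmoothSection V F₀ E₀} (hz : z ∈ flat (r + 1) x)
    (hB : jet (r + 1) x z ∈ jetImage D (r + 1) x) :
    derivAt (r + 1) x z ∈ (hD.1.symbolFamily x).image (r + 1) := by
  obtain ⟨f, hf⟩ := mem_jetImage_iff.1 hB
  have hDf : D f ∈ flat (r + 1) x := by
    have := Submodule.sub_mem _ hz (flat_anti (Nat.le_succ (r + 1)) x hf)
    rwa [sub_sub_cancel] at this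
  obtain ⟨g, hg, hfg⟩ := hD.exists_solution hR hDf
  refine hD.1.mem_image_symbolFamily.2 ⟨f - g, hfg, ?_⟩
  refine (derivAt_eq_of_sub_mem ?_).symm
  rw [map_sub, sub_sub_eq_add_sub, add_sub_right_comm]
  exact Submodule.add_mem _ hf hg

theorem symbol_jetImage (hD : IsQuotientOperator R D) (hR : IsFormallyIntegrable R) (r : ℕ)
    (x : X) : symbol (jetImage D (r + 1)) x = (hD.1.symbolFamily x).image (r + 1) := by
  ext T
  constructor
  · rintro ⟨z, ⟨hz, hB⟩, rfl⟩
    exact hD.derivAt_mem_image hR hz hB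
  · intro hT
    obtain ⟨f, hf, rfl⟩ := hD.1.mem_image_symbolFamily.1 hT
    exact ⟨D f, ⟨hD.1.map_mem_flat hf, ⟨f, rfl⟩⟩, rfl⟩

/-- If `H^1` of the images of the prolonged symbols vanishes in orders `≥ k + 1`, the conditions of
order `≤ k + 1` generate all compatibility conditions. -/
theorem exists_of_forall_isCC (hD : IsQuotientOperator R D) (hR : IsFormallyIntegrable R) {k : ℕ}
    {x : X} (hB : IsSubbundle (jetImage D (k + 1)))
    (hex : ∀ r, DeltaExact (hD.1.symbolFamily x).image 0 (k + 1 + r)) (r : ℕ)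
    (z : SmoothSection V F₀ E₀) (hz : ∀ P, IsCC (k + 1) D P → P z ∈ flat (r + 1) x) :
    jet (k + 1 + r) x z ∈ jetImage D (k + 1 + r) x := by
  induction r generalizing z with
  | zero =>
    exact hB.mem_of_forall_equation fun P hP =>
      mem_flat_one_iff.1 (hz P (isEquation_jetImage_iff.1 hP))
  | succ r ih =>
    -- By induction `z` can be replaced by a section `y` whose derivatives of order `≤ k + 1 + r`
    -- vanish. Those of the next order have contractions coming from the directional derivatives
    -- of `y`, to which the induction hypothesis applies.
    obtain ⟨f, hf⟩ := mem_jetImage_iff.1 (ih z fun P hP => flat_anti (Nat.le_succ _) x (hz P hP))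
    set y := z - D f
    have hy : ∀ P, IsCC (k + 1) D P → P y ∈ flat (r + 2) x := fun P hP => by
      rw [map_sub, hP.2, sub_zero]
      exact hz P hP
    have hdir : ∀ v P, IsCC (k + 1) D P → P (dirDeriv x v y) ∈ flat (r + 1) x := fun v P hP => by
      have h1 := hP.1.commutator_mem_flat (r := r + 1) v hf
      have h2 := Submodule.add_mem _ h1 (dirDeriv_mem_flat v (hy P hP))
      rwa [sub_add_cancel] at h2
    have hsym : derivAt (k + 1 + r + 1) x y ∈ (hD.1.symbolFamily x).image (k + 1 + r + 1) := by
      refine (deltaExact_zero_iff (SymbolFamily.image_le _ _)).1 (hex r)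
        (mem_prolongSymbolOne.2 ⟨derivAt_mem_symTensor _ x y, fun v => ?_⟩)
      rw [← derivAt_dirDeriv]
      have h1 := ih (dirDeriv x v y) (hdir v)
      have h2 := dirDeriv_mem_flat v hf
      generalize hm : k + 1 + r = m at h1 h2 ⊢
      obtain ⟨m, rfl⟩ : ∃ m', m = m' + 1 := ⟨k + r, by omega⟩
      exact hD.derivAt_mem_image hR h2 h1
    obtain ⟨g, hg, e⟩ := hD.1.mem_image_symbolFamily.1 hsym
    refine mem_jetImage_iff.2 ⟨f + g, ?_⟩
    rw [map_add, ← sub_sub]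
    refine mem_flat_succ_iff.2 ⟨Submodule.sub_mem _ hf (hD.1.map_mem_flat hg), ?_⟩
    rw [map_sub, sub_eq_zero]
    exact e.symm

/-- Necessity of the vanishing of `H^1` of the images for the compatibility conditions to be
generated in order `≤ l`. -/
theorem deltaExact_image_of_cCGenerated (hD : IsQuotientOperator R D) (hR : IsFormallyIntegrable R)
    {l : ℕ} (h : CCGeneratedInOrder l D) (x : X) {r : ℕ} (hr : l ≤ r + 1) :
    DeltaExact (hD.1.symbolFamily x).image 0 (r + 1) := by
  refine (deltaExact_zero_iff (SymbolFamily.image_le _ _)).2 fun ζ hζ => ?_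
  obtain ⟨hs, hc⟩ := mem_prolongSymbolOne.1 hζ
  obtain ⟨z, hz, rfl⟩ := exists_mem_flat_derivAt_eq E₀ x hs
  obtain ⟨t, ht⟩ := Nat.exists_eq_add_of_le hr
  refine hD.derivAt_mem_image hR hz ?_
  rw [show r + 1 + 1 = l + (t + 1) by omega] at hz ⊢
  refine (h (t + 1) x z).2 fun P hP => jet_eq_zero_iff.2 (mem_flat_succ_iff.2
    ⟨hP.1.map_mem_flat hz, eq_zero_of_contract_eq_zero fun v => ?_⟩)
  -- Up to terms of higher order, `∂_v (P z)` is `P (∂_v z)`, and `∂_v z` is some `D f`.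
  rw [← derivAt_dirDeriv, ← derivAt_eq_of_sub_mem (hP.1.commutator_mem_flat v hz)]
  obtain ⟨f, hf, e⟩ := hD.1.mem_image_symbolFamily.1 (hc v)
  have h1 : dirDeriv x v z - D f ∈ flat (l + (t + 1)) x := by
    rw [show l + (t + 1) = r + 1 + 1 by omega] at hz ⊢
    refine mem_flat_succ_iff.2 ⟨Submodule.sub_mem _ (dirDeriv_mem_flat v hz)
      (hD.1.map_mem_flat hf), ?_⟩
    rw [map_sub, e, derivAt_dirDeriv, sub_self]
  have h2 := hP.1.map_mem_flat h1
  rw [map_sub, hP.2, sub_zero] at h2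
  exact (mem_flat_succ_iff.1 h2).2

/-- If the compatibility conditions are generated in order `0` there are none, because `D` takes all
values at each point; then the prolonged symbols are onto and the system is involutive. -/
theorem isInvolutive_of_cCGenerated_zero (hD : IsQuotientOperator R D)
    (hR : IsFormallyIntegrable R) (h : CCGeneratedInOrder 0 D) : IsInvolutive R := by
  have hsurj : ∀ (x : X) (r : ℕ) (z : SmoothSection V F₀ E₀), jet r x z ∈ jetImage D r x := by
    intro x r z
    rw [← Nat.zero_add r]
    refine (h r x z).2 fun P hP => ?_
    have : P z = 0 := by
      ext y
      obtain ⟨f, hf⟩ := hD.2.2 y (z y)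
      have h0 := hP.1 y (z - D f) (jet_eq_zero_iff.2 (mem_flat_one_iff.2 (sub_eq_zero.2 hf.symm)))
      rwa [map_sub, hP.2, sub_zero] at h0
    rw [this, map_zero]
  refine ⟨hR, fun x => ?_⟩
  have := hD.isAcyclic_prolongSymbol_iff x (Module.finrank ℝ V) 0
  refine this.2 fun i r _ => ?_
  refine SymbolFamily.deltaExact_kernel_of_surjective (hD.1.isKernel_kernelSymbol x)
    (fun m => le_antisymm (SymbolFamily.image_le _ _) fun T hT => ?_) i (0 + r)
  obtain ⟨z, hz, rfl⟩ := exists_mem_flat_derivAt_eq E₀ x hT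
  exact hD.derivAt_mem_image hR hz (hsurj x _ z)

theorem isSubbundle_jetImage (hD : IsQuotientOperator R D) (hR : IsFormallyIntegrable R) (r : ℕ) :
    IsSubbundle (jetImage D r) :=
  FormalPDE.isSubbundle_jetImage (hR r).1 fun _ _ => hD.mem_prolong_iff.trans jet_eq_zero_iff.symm

/-- The consequences of the vanishing of `H^1` of the images of the prolonged symbols in orders
`≥ k + 1`. -/
theorem generated_and_formallyIntegrable (hD : IsQuotientOperator R D)
    (hR : IsFormallyIntegrable R) {k : ℕ}
    (hex : ∀ x r, DeltaExact (hD.1.symbolFamily x).image 0 (k + 1 + r)) :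
    CCGeneratedInOrder (k + 1) D ∧ IsFormallyIntegrable (jetImage D (k + 1)) ∧
      ∀ r x, prolong (jetImage D (k + 1)) r x = jetImage D (k + 1 + r) x := by
  have h1 : CCGeneratedInOrder (k + 1) D := by
    refine fun r x z => ⟨fun hz P hP => ?_, fun hz => hD.exists_of_forall_isCC hR
      (hD.isSubbundle_jetImage hR _) (hex x) r z fun P hP => jet_eq_zero_iff.1 (hz P hP)⟩
    obtain ⟨f, hf⟩ := mem_jetImage_iff.1 hz
    have h2 := hP.1.map_mem_flat (r := r + 1) hf
    rw [map_sub, hP.2, sub_zero] at h2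
    exact jet_eq_zero_iff.2 h2
  have h2 : ∀ r x, prolong (jetImage D (k + 1)) r x = jetImage D (k + 1 + r) x := by
    refine fun r x => jet_submodule_ext fun z => ?_
    rw [FormalPDE.mem_prolong_iff, h1 r x z]
    simp only [isEquation_jetImage_iff, jet_eq_zero_iff]
  refine ⟨h1, fun r => ⟨?_, fun x => ?_⟩, h2⟩
  · rw [show prolong (jetImage D (k + 1)) r = jetImage D (k + 1 + r) from funext (h2 r)]
    exact hD.isSubbundle_jetImage hR _
  · rw [h2, h2]
    change _ = LinearMap.range (jetProj (k + 1 + r) x ∘ₗ jet (k + 1 + r + 1) x ∘ₗ D)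
    rw [LinearMap.range_comp]
    rfl

end IsQuotientOperator

end CompatibilityConditions

end FormalPDE

/-! ### The order of the compatibility conditions -/

theorem theorem3p10
    {V : Type*} [NormedAddCommGroup V] [NormedSpace ℝ V] [FiniteDimensional ℝ V]
    {X : Type*} [TopologicalSpace X] [T2Space X] [ChartedSpace V X] [IsManifold 𝓘(ℝ, V) ∞ X]
    {F : Type*} [NormedAddCommGroup F] [NormedSpace ℝ F] [FiniteDimensional ℝ F]
    {E : X → Type*} [TopologicalSpace (Bundle.TotalSpace F E)] [∀ x, TopologicalSpace (E x)]
    [∀ x, AddCommGroup (E x)] [∀ x, Module ℝ (E x)] [FiberBundle F E] [VectorBundle ℝ F E]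
    [ContMDiffVectorBundle ∞ F E 𝓘(ℝ, V)]
    {F₀ : Type*} [NormedAddCommGroup F₀] [NormedSpace ℝ F₀] [FiniteDimensional ℝ F₀]
    {E₀ : X → Type*} [TopologicalSpace (Bundle.TotalSpace F₀ E₀)] [∀ x, TopologicalSpace (E₀ x)]
    [∀ x, AddCommGroup (E₀ x)] [∀ x, Module ℝ (E₀ x)] [FiberBundle F₀ E₀] [VectorBundle ℝ F₀ E₀]
    [ContMDiffVectorBundle ∞ F₀ E₀ 𝓘(ℝ, V)]
    (q : ℕ) (R : ∀ x : X, Submodule ℝ (FormalPDE.Jet V F E q x))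
    (D : FormalPDE.SmoothSection V F E →ₗ[ℝ] FormalPDE.SmoothSection V F₀ E₀)
    (hD : FormalPDE.IsQuotientOperator R D)
    (hR : FormalPDE.IsFormallyIntegrable R) :
    (∀ s : ℕ, ¬ FormalPDE.IsInvolutive R → FormalPDE.BecomesAcyclicAfter 2 R s →
      FormalPDE.GeneratingCCOrder D (s + 1) ∧
      FormalPDE.IsFormallyIntegrable (FormalPDE.jetImage D (s + 1)) ∧
      ∀ (r : ℕ) (x : X), FormalPDE.prolong (FormalPDE.jetImage D (s + 1)) r x =
        FormalPDE.jetImage D (s + 1 + r) x) ∧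
    (FormalPDE.IsInvolutive R →
      FormalPDE.CCGeneratedInOrder 1 D ∧
      FormalPDE.IsInvolutive (FormalPDE.jetImage D 1) ∧
      ∀ (r : ℕ) (x : X), FormalPDE.prolong (FormalPDE.jetImage D 1) r x =
        FormalPDE.jetImage D (1 + r) x) := by
  have hK := hD.1.isKernel_kernelSymbol
  constructor
  · intro s hni hs
    have hex : ∀ x r, FormalPDE.DeltaExact (hD.1.symbolFamily x).image 0 (s + 1 + r) := by
      intro x r
      rw [show s + 1 + r = s + r + 1 by omega]
      exact FormalPDE.SymbolFamily.deltaExact_image (hK x)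
        ((hD.isAcyclic_prolongSymbol_iff x 2 s).1 (hs.1 x) 1 r le_rfl)
    obtain ⟨h1, h2⟩ := hD.generated_and_formallyIntegrable hR hex
    refine ⟨⟨h1, fun l hl => ?_⟩, h2⟩
    -- Conditions of order `0` would make `R` involutive; in order `t + 1` the vanishing of `H^1` of
    -- the images that they force is the vanishing of `H^2` of the kernels after `t` prolongations.
    cases l with
    | zero => exact absurd (hD.isInvolutive_of_cCGenerated_zero hR hl) hni
    | succ t =>
      refine Nat.succ_le_succ (hs.2 fun x => (hD.isAcyclic_prolongSymbol_iff x 2 t).2 ?_)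
      intro i r hi
      obtain rfl | rfl : i = 0 ∨ i = 1 := by omega
      · exact FormalPDE.SymbolFamily.deltaExact_kernel_zero (hK x) (t + r)
      · refine FormalPDE.SymbolFamily.deltaExact_kernel (hK x) (r := t + r) ?_
        exact hD.deltaExact_image_of_cCGenerated hR hl x (by omega)
  · intro hI
    have hex : ∀ x i r, FormalPDE.DeltaExact (hD.1.symbolFamily x).image i (r + 1) := by
      intro x i r
      refine FormalPDE.SymbolFamily.deltaExact_image (hK x) ?_
      by_cases hi : i + 1 + 1 ≤ Module.finrank ℝ V
      · have h0 := (hD.isAcyclic_prolongSymbol_iff x _ 0).1 (hI.2 x) (i + 1) r hi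
        rwa [Nat.zero_add] at h0
      -- Beyond degree `n` there are no alternating forms.
      · exact FormalPDE.deltaExact_of_finrank_lt _ (by omega)
    obtain ⟨h1, h2, h3⟩ := hD.generated_and_formallyIntegrable hR (k := 0) fun x r => by
      rw [show 0 + 1 + r = r + 1 by omega]
      exact hex x 0 r
    refine ⟨h1, ⟨h2, fun x => ?_⟩, h3⟩
    rw [FormalPDE.IsInvolutiveSymbol, hD.symbol_jetImage hR 0 x]
    refine (FormalPDE.isAcyclic_iff (k := 0 + 1) (fun m hm => ?_) _).2 fun i r _ => ?_
    · obtain ⟨r, rfl⟩ : ∃ r, m = r + 1 := ⟨m - 1, by omega⟩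
      refine le_antisymm ((FormalPDE.deltaExact_zero_iff
        (FormalPDE.SymbolFamily.image_le _ _)).1 (hex x 0 r)) ?_
      exact FormalPDE.SymbolFamily.image_le_prolongSymbolOne _ _
    · rw [show 0 + 1 + r = r + 1 by omega]
      exact hex x i r
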